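/- Let $\nu\in\mathbb{R}$ and let $u=(u^1,u^2,u^3)$ satisfy $-\nu<u^1<u^2<u^3$. Put $R(\lambda)=(\lambda+\nu)(\lambda-u^1)(\lambda-u^2)(\lambda-u^3)$, $$k(u)=2\pi\Big(\oint_a\frac{(\lambda+\nu)\,d\lambda}{\sqrt{R(\lambda)}}\Big)^{-1},\qquad \omega(u)=(2\nu+u^1+u^2+u^3)\,k(u),$$ where $a$ is the cycle around the cut $[u^1,u^2]$ of the curve $\mu^2=R(\lambda)$, so that $\oint_a=2\int_{u^1}^{u^2}$ with the positive square root. Let $$C^i(u)=\frac{\partial_{u^i}\omega(u)}{\partial_{u^i}k(u)},\qquad i=1,2,3,$$ be the speeds of the one-phase Camassa–Holm (CH) modulation equations $\partial_tu^i+C^i(u)\,\partial_xu^i=0$ $(i=1,2,3)$. Let $$K(s)=\int_0^{\pi/2}\frac{d\psi}{\sqrt{1-s^2\sin^2\psi}},\quad E(s)=\int_0^{\pi/2}\sqrt{1-s^2\sin^2\psi}\,d\psi,\quad \Lambda(K(s),\rho,s)=\int_0^{K(s)}\frac{dv}{1-\rho^2\,\mathrm{sn}^2v}$$ be the complete elliptic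 integrals of the first, second and third kind, where $\mathrm{sn}$ is the Jacobi elliptic function of modulus $s$ and $$s^2=\frac{(u^2-u^1)(u^3+\nu)}{(u^3-u^1)(u^2+\nu)},\qquad \rho^2=\frac{u^2-u^1}{u^2+\nu},\qquad s,\rho\ge 0 .$$ (1) The speeds are well defined ($k>0$, $k$ and $\omega$ have all first partial derivatives, and $\partial_{u^i}k\neq0$), and, with nonvanishing denominators, $$C^1=u^1+u^2+u^3+2\nu+2\,\frac{(u^1+\nu)(u^1-u^2)\,\Lambda(K(s),\rho,s)}{(u^2+\nu)\,[K(s)-E(s)]},$$ $$C^2=u^1+u^2+u^3+2\nu+\frac{2(u^2-u^1)\,\Lambda(K(s),\rho,s)}{K(s)-\dfrac{(u^2+\nu)(u^3-u^1)}{(u^1+\nu)(u^3-u^2)}E(s)},$$ $$C^3=u^1+u^2+u^3+2\nu+2\,\frac{(u^1+\nu)(u^3-u^2)\,\Lambda(K(s),\rho,s)}{(u^2+\nu)\,E(s)}.$$ (2) For $-\nu<u^1<u^2<u^3$ the equations $\partial_tu^i+C^i(u)\,\partial_xu^i=0$ are hyperbolic (the coefficient matrix is diagonalizable over $\mathbb{R}$),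 and $C^1(u)<C^3(u)$, $C^2(u)<C^3(u)$. (3) When two Riemann invariants coalesce, the modulation equations reduce to the dispersionless CH equation $\partial_t\mathsf{u}+(3\mathsf{u}+2\nu)\,\partial_x\mathsf{u}=0$ for the remaining invariant. Precisely: if $-\nu<w<v$, then, as $u\to(w,v,v)$ within $-\nu<u^1<u^2<u^3$, all three speeds have finite limits, $C^1\to3w+2\nu$, and $C^2$ and $C^3$ have the same limit; if $-\nu<v<w$, then, as $u\to(v,v,w)$ within $-\nu<u^1<u^2<u^3$, all three speeds have finite limits, $C^3\to3w+2\nu$, and $C^1$ and $C^2$ have the same limit. Consequently, with the speeds replaced by these limits, fields of the form $(w,v,v)$ with $-\nu<w<v$, respectively $(v,v,w)$ with $-\nu<v<w$, solve the three equations on an open set of the $(x,t)$-plane (as differentiable functions) if and only if $w_t+(3w+2\nu)w_x=0$ and $v$ satisfies $v_t+c\,v_x=0$ with $c$ the common limit of the two other speeds. -/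

import Mathlib

open Filter Topology MeasureTheory
open scoped Matrix

namespace CHWhitham

noncomputable section

/-! ### Elliptic integrals and the Jacobi function `sn` (all as functions of the modulus `s`) -/

/-- Incomplete elliptic integral of the first kind with amplitude `φ` and modulus `s`. -/
def ellF (φ s : ℝ) : ℝ := ∫ ψ in (0 : ℝ)..φ, 1 / Real.sqrt (1 - s ^ 2 * Real.sin ψ ^ 2)

/-- Complete elliptic integral of the first kind. -/
def ellK (s : ℝ) : ℝ :=
  ∫ ψ in (0 : ℝ)..(Real.pi / 2), 1 / Real.sqrt (1 - s ^ 2 * Real.sin ψ ^ 2)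

/-- Complete elliptic integral of the second kind. -/
def ellE (s : ℝ) : ℝ :=
  ∫ ψ in (0 : ℝ)..(Real.pi / 2), Real.sqrt (1 - s ^ 2 * Real.sin ψ ^ 2)

/-- Jacobi amplitude: the inverse of `φ ↦ ellF φ s` (a bijection of `ℝ` for `s ^ 2 < 1`). -/
def jacobiAm (v s : ℝ) : ℝ := Function.invFun (fun φ => ellF φ s) v

/-- Jacobi elliptic function `sn`. -/
def jacobiSn (v s : ℝ) : ℝ := Real.sin (jacobiAm v s)

/-- Elliptic integral of the third kind `Λ(z, ρ, s) = ∫₀ᶻ dv / (1 - ρ² sn²(v; s))`. -/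
def ellLambda (z ρ s : ℝ) : ℝ := ∫ v in (0 : ℝ)..z, 1 / (1 - ρ ^ 2 * jacobiSn v s ^ 2)

/-! ### The wave number, the frequency and the speeds

A state is `u : Fin 3 → ℝ`; the Riemann invariants `u¹, u², u³` are `u 0, u 1, u 2`. -/

/-- The states with `-ν < u¹ < u² < u³`. -/
def domain (ν : ℝ) : Set (Fin 3 → ℝ) := {u | -ν < u 0 ∧ u 0 < u 1 ∧ u 1 < u 2}

/-- `R(λ) = (λ + ν)(λ - u¹)(λ - u²)(λ - u³)`. -/
def R (ν : ℝ) (u : Fin 3 → ℝ) (l : ℝ) : ℝ := (l + ν) * (l - u 0) * (l - u 1) * (l - u 2)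

/-- The period of `(λ + ν) dλ / √R(λ)` over the cycle `a` around the cut `[u¹, u²]`: the two
sheets contribute equally, so that it is twice the integral over the cut. -/
def period (ν : ℝ) (u : Fin 3 → ℝ) : ℝ :=
  2 * ∫ l in (u 0)..(u 1), (l + ν) / Real.sqrt (R ν u l)

/-- Wave number `k`. -/
def waveNumber (ν : ℝ) (u : Fin 3 → ℝ) : ℝ := 2 * Real.pi * (period ν u)⁻¹

/-- Frequency `ω`. -/
def frequency (ν : ℝ) (u : Fin 3 → ℝ) : ℝ := (2 * ν + u 0 + u 1 + u 2) * waveNumber ν u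

/-- Partial derivative `∂f/∂uⁱ`. -/
def pderiv (i : Fin 3) (f : (Fin 3 → ℝ) → ℝ) (u : Fin 3 → ℝ) : ℝ :=
  deriv (fun y => f (Function.update u i y)) (u i)

/-- The Whitham speeds `Cⁱ(u) = ∂_{uⁱ} ω / ∂_{uⁱ} k`. -/
def speed (ν : ℝ) (i : Fin 3) (u : Fin 3 → ℝ) : ℝ :=
  pderiv i (frequency ν) u / pderiv i (waveNumber ν) u

/-- The modulus `s ≥ 0`, `s² = (u² - u¹)(u³ + ν) / ((u³ - u¹)(u² + ν))`. -/
def modulus (ν : ℝ) (u : Fin 3 → ℝ) : ℝ :=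
  Real.sqrt (((u 1 - u 0) * (u 2 + ν)) / ((u 2 - u 0) * (u 1 + ν)))

/-- The parameter `ρ ≥ 0`, `ρ² = (u² - u¹) / (u² + ν)`. -/
def rho (ν : ℝ) (u : Fin 3 → ℝ) : ℝ := Real.sqrt ((u 1 - u 0) / (u 1 + ν))

/-! ### First order quasilinear systems -/

/-- The system `∂ₜU + A(U) ∂ₓU = 0` is hyperbolic at a state with coefficient matrix `A` when `A`
is diagonalizable over `ℝ`: real eigenvalues and a full set of real eigenvectors. -/
def IsHyperbolicMatrix {n : ℕ} (A : Matrix (Fin n) (Fin n) ℝ) : Prop :=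
  ∃ (P : Matrix (Fin n) (Fin n) ℝ) (d : Fin n → ℝ), IsUnit P ∧ A * P = P * Matrix.diagonal d

/-- `U(x, t)` is differentiable and satisfies `∂ₜU + A(U) ∂ₓU = 0` at the points `(x, t) ∈ S`. -/
def SolvesSystem {n : ℕ} (A : (Fin n → ℝ) → Matrix (Fin n) (Fin n) ℝ) (S : Set (ℝ × ℝ))
    (U : ℝ → ℝ → Fin n → ℝ) : Prop :=
  ∀ x t : ℝ, (x, t) ∈ S →
    DifferentiableAt ℝ (fun p : ℝ × ℝ => U p.1 p.2) (x, t) ∧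
    deriv (fun t' => U x t') t + A (U x t) *ᵥ deriv (fun x' => U x' t) x = 0

/-- `w(x, t)` is differentiable and satisfies `∂ₜw + c ∂ₓw = 0` at the points `(x, t) ∈ S`. -/
def SolvesTransport (c : ℝ → ℝ → ℝ) (S : Set (ℝ × ℝ)) (w : ℝ → ℝ → ℝ) : Prop :=
  ∀ x t : ℝ, (x, t) ∈ S →
    DifferentiableAt ℝ (fun p : ℝ × ℝ => w p.1 p.2) (x, t) ∧
    deriv (fun t' => w x t') t + c x t * deriv (fun x' => w x' t) x = 0

/-- The dispersionless Camassa-Holm equation `wₜ + (3w + 2ν) wₓ = 0` on `S`. -/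
def SolvesDispersionlessCH (ν : ℝ) (S : Set (ℝ × ℝ)) (w : ℝ → ℝ → ℝ) : Prop :=
  SolvesTransport (fun x t => 3 * w x t + 2 * ν) S w

/-- Coefficient matrix of the modulation equations `∂ₜuⁱ + Cⁱ(u) ∂ₓuⁱ = 0`. -/
def whithamMatrix (ν : ℝ) (u : Fin 3 → ℝ) : Matrix (Fin 3) (Fin 3) ℝ :=
  Matrix.diagonal (fun i => speed ν i u)

/-- The limit of the speeds at a boundary state, taken from inside `-ν < u¹ < u² < u³`. -/
def limitSpeed (ν : ℝ) (i : Fin 3) : (Fin 3 → ℝ) → ℝ := extendFrom (domain ν) (speed ν i)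

/-- Coefficient matrix of the limiting modulation equations. -/
def limitMatrix (ν : ℝ) (u : Fin 3 → ℝ) : Matrix (Fin 3) (Fin 3) ℝ :=
  Matrix.diagonal (fun i => limitSpeed ν i u)

end

end CHWhitham

/-!
# Speeds of the one-phase Camassa-Holm modulation equations

Put `a = u¹ + ν`, `b = u² + ν`, `c = u³ + ν` and let `P` be the period. Since
`ω = (2ν + u¹ + u² + u³) k` with `k = 2π / P`, the speeds are
`Cⁱ = 2ν + u¹ + u² + u³ - P / ∂ᵢP` (`speed_eq`), so that everything is about `P` and its gradient.

The substitution `x = a cos² θ + b sin² θ` on the cut removes the singularities at its ends: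
`P = 4 ∫ √x / √(c - x) dθ` over `[0, π / 2]` (`intervalIntegrable_and_period_eq`). This integral may
be differentiated under the integral sign, and the derivatives with respect to `a`, `b`, `c` have
integrands of the signs `+`, `+`, `-`. Hence `∂ᵢP ≠ 0`, and `C¹, C²` lie below
`2ν + u¹ + u² + u³` while `C³` lies above it (`speed_lt_speed_two`).

The further substitution `tan θ = √(a / b) tan ψ` (`integral_comp_cutPoint`) turns `P` into a
multiple of the integral of the third kind and the derivatives into integrals of `1`, `cos²`, `sin²`
against `(1 - s² sin² ψ)^(-3/2)`. The latter are combinations of `K` and `E`, because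
`(1 - s²) ∫ (1 - s² sin² ψ)^(-3/2) dψ = E` (`integral_inv_sqrt_cube`). This gives the explicit
speeds (`speed_formulas`).

When `a` and `b` coalesce, the regular integrals are continuous and the limits are evaluated
directly. When `b` and `c` coalesce,
`L = ∫ (c - x)^(-1/2) dθ` tends to infinity like a logarithm, while
`T = ∫ (c - x)^(-3/2) dθ` grows like `1 / (c - b)`, so that `L / T → 0`. As `P` and `∂₁P` are
asymptotic to multiples of `L`, and `∂₂P`, `∂₃P` are at least of the order of `T`, the ratio
`P / ∂₁P` tends to `2 (c - a)` and the other two tend to `0`.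
-/

namespace CHWhitham

noncomputable section

/-! ### Integrals depending on a parameter -/

theorem continuousAt_integral_of_continuousOn {X : Type*} [TopologicalSpace X]
    [FirstCountableTopology X] {f : X → ℝ → ℝ} {U : Set X} (hU : IsOpen U)
    (hf : ContinuousOn (fun p : X × ℝ => f p.1 p.2) (U ×ˢ Set.univ)) (a b : ℝ) {x : X}
    (hx : x ∈ U) : ContinuousAt (fun y => ∫ t in a..b, f y t) x := by
  have h1 : Continuous (Function.uncurry fun (y : U) (t : ℝ) => f y t) := by
    have : Continuous fun p : U × ℝ => ((p.1 : X), p.2) := by fun_prop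
    exact hf.comp_continuous this fun p => ⟨p.1.2, trivial⟩
  have h2 := intervalIntegral.continuous_parametric_intervalIntegral_of_continuous'
    (μ := volume) h1 a b
  have h3 : ContinuousOn (fun y => ∫ t in a..b, f y t) U :=
    continuousOn_iff_continuous_domRestrict.2 h2
  exact h3.continuousAt (hU.mem_nhds hx)

/-- Differentiation under the integral sign, when the partial derivative is jointly continuous. -/
theorem hasDerivAt_integral_of_continuousOn {f f' : ℝ → ℝ → ℝ} {U : Set ℝ} (hU : IsOpen U)
    (hf : ∀ y ∈ U, Continuous (f y))
    (hf' : ContinuousOn (fun p : ℝ × ℝ => f' p.1 p.2) (U ×ˢ Set.univ))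
    (hd : ∀ y ∈ U, ∀ t, HasDerivAt (fun y => f y t) (f' y t) y) (a b : ℝ) {x : ℝ} (hx : x ∈ U) :
    HasDerivAt (fun y => ∫ t in a..b, f y t) (∫ t in a..b, f' x t) x := by
  obtain ⟨ε, hε, hεU⟩ := Metric.nhds_basis_closedBall.mem_iff.1 (hU.mem_nhds hx)
  have hK : IsCompact (Metric.closedBall x ε ×ˢ Set.uIcc a b) :=
    (isCompact_closedBall x ε).prod isCompact_uIcc
  obtain ⟨C, hC⟩ := hK.exists_bound_of_continuousOn
    (hf'.mono (Set.prod_mono hεU (Set.subset_univ _)))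
  have hcx : Continuous (f' x) :=
    hf'.comp_continuous (by fun_prop : Continuous fun t : ℝ => (x, t)) fun t => ⟨hx, trivial⟩
  refine (intervalIntegral.hasDerivAt_integral_of_dominated_loc_of_deriv_le
    (Metric.closedBall_mem_nhds x hε) ?_ ((hf x hx).intervalIntegrable a b)
    hcx.aestronglyMeasurable (bound := fun _ => C) ?_ (by simp) ?_).2
  · filter_upwards [hU.mem_nhds hx] with y hy using (hf y hy).aestronglyMeasurable
  · exact ae_of_all _ fun t ht y hy => hC (y, t) ⟨hy, Set.uIoc_subset_uIcc ht⟩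
  · exact ae_of_all _ fun t _ y hy => hd y (hεU hy) t

/-! ### The period as a regular integral -/

/-- The point `a cos² θ + b sin² θ` of the segment from `a` to `b`. -/
def cutPoint (a b θ : ℝ) : ℝ := a * Real.cos θ ^ 2 + b * Real.sin θ ^ 2

/-- The integral of `√x / √(c - x)` along the cut `[a, b]`, parametrized by `cutPoint`. -/
def perInt (a b c : ℝ) : ℝ :=
  ∫ θ in (0 : ℝ)..(Real.pi / 2), √(cutPoint a b θ) / √(c - cutPoint a b θ)

/-- Up to the factor `c / 2`, the partial derivative of `perInt` with respect to `a`. -/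
def perA (a b c : ℝ) : ℝ :=
  ∫ θ in (0 : ℝ)..(Real.pi / 2),
    Real.cos θ ^ 2 / (√(cutPoint a b θ) * √(c - cutPoint a b θ) ^ 3)

/-- Up to the factor `c / 2`, the partial derivative of `perInt` with respect to `b`. -/
def perB (a b c : ℝ) : ℝ :=
  ∫ θ in (0 : ℝ)..(Real.pi / 2),
    Real.sin θ ^ 2 / (√(cutPoint a b θ) * √(c - cutPoint a b θ) ^ 3)

/-- Up to the factor `-1 / 2`, the partial derivative of `perInt` with respect to `c`. -/
def perC (a b c : ℝ) : ℝ :=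
  ∫ θ in (0 : ℝ)..(Real.pi / 2), √(cutPoint a b θ) / √(c - cutPoint a b θ) ^ 3

/-- The triples `(a, b, c)` for which the segment from `a` to `b` lies in `(0, c)`. Unlike the
domain of the modulation equations it is open and contains the triples with `a = b`. -/
def cutRegion : Set (ℝ × ℝ × ℝ) := {p | 0 < p.1 ∧ 0 < p.2.1 ∧ p.1 < p.2.2 ∧ p.2.1 < p.2.2}

theorem isOpen_cutRegion : IsOpen cutRegion := by
  unfold cutRegion
  simp only [Set.ofPred_and]
  refine (isOpen_lt ?_ ?_).inter ((isOpen_lt ?_ ?_).inter ((isOpen_lt ?_ ?_).inter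
    (isOpen_lt ?_ ?_))) <;> fun_prop

@[fun_prop]
theorem continuous_cutPoint {X : Type*} [TopologicalSpace X] {a b t : X → ℝ} (ha : Continuous a)
    (hb : Continuous b) (ht : Continuous t) : Continuous fun x => cutPoint (a x) (b x) (t x) := by
  unfold cutPoint; fun_prop

theorem le_cutPoint {a b : ℝ} (h : a ≤ b) (θ : ℝ) : a ≤ cutPoint a b θ := by
  unfold cutPoint
  linear_combination mul_nonneg (sub_nonneg.2 h) (sq_nonneg (Real.sin θ)) -
    a * Real.sin_sq_add_cos_sq θ

theorem cutPoint_le {a b : ℝ} (h : a ≤ b) (θ : ℝ) : cutPoint a b θ ≤ b := by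
  unfold cutPoint
  linear_combination mul_nonneg (sub_nonneg.2 h) (sq_nonneg (Real.cos θ)) +
    b * Real.sin_sq_add_cos_sq θ

theorem cutPoint_pos {a b : ℝ} (ha : 0 < a) (hb : 0 < b) (θ : ℝ) : 0 < cutPoint a b θ := by
  unfold cutPoint
  have h := Real.sin_sq_add_cos_sq θ
  -- One of the two terms is positive, according to whether `sin θ` vanishes.
  rcases (sq_nonneg (Real.sin θ)).eq_or_lt with h0 | h0
  · rw [← h0] at h ⊢
    rw [zero_add] at h
    simp [h, ha]
  · positivity

theorem cutPoint_lt {a b c : ℝ} (ha : a < c) (hb : b < c) (θ : ℝ) : cutPoint a b θ < c := by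
  have h := cutPoint_pos (sub_pos.2 ha) (sub_pos.2 hb) θ
  have h' := Real.sin_sq_add_cos_sq θ
  unfold cutPoint at *
  linear_combination h + c * h'

theorem sub_cutPoint_pos {a b c : ℝ} (ha : a < c) (hb : b < c) (θ : ℝ) :
    0 < c - cutPoint a b θ := sub_pos.2 (cutPoint_lt ha hb θ)

/-- Joint continuity of the integrands of `perInt`, `perA`, `perB` and `perC`. -/
theorem continuousOn_integrands :
    ContinuousOn (fun p : (ℝ × ℝ × ℝ) × ℝ => √(cutPoint p.1.1 p.1.2.1 p.2) /
      √(p.1.2.2 - cutPoint p.1.1 p.1.2.1 p.2)) (cutRegion ×ˢ Set.univ) ∧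
    ContinuousOn (fun p : (ℝ × ℝ × ℝ) × ℝ => Real.cos p.2 ^ 2 / (√(cutPoint p.1.1 p.1.2.1 p.2) *
      √(p.1.2.2 - cutPoint p.1.1 p.1.2.1 p.2) ^ 3)) (cutRegion ×ˢ Set.univ) ∧
    ContinuousOn (fun p : (ℝ × ℝ × ℝ) × ℝ => Real.sin p.2 ^ 2 / (√(cutPoint p.1.1 p.1.2.1 p.2) *
      √(p.1.2.2 - cutPoint p.1.1 p.1.2.1 p.2) ^ 3)) (cutRegion ×ˢ Set.univ) ∧
    ContinuousOn (fun p : (ℝ × ℝ × ℝ) × ℝ => √(cutPoint p.1.1 p.1.2.1 p.2) /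
      √(p.1.2.2 - cutPoint p.1.1 p.1.2.1 p.2) ^ 3) (cutRegion ×ˢ Set.univ) := by
  have h1 : ∀ p : (ℝ × ℝ × ℝ) × ℝ, p ∈ cutRegion ×ˢ Set.univ →
      √(cutPoint p.1.1 p.1.2.1 p.2) ≠ 0 := fun p hp =>
    (Real.sqrt_pos.2 (cutPoint_pos hp.1.1 hp.1.2.1 _)).ne'
  have h2 : ∀ p : (ℝ × ℝ × ℝ) × ℝ, p ∈ cutRegion ×ˢ Set.univ →
      √(p.1.2.2 - cutPoint p.1.1 p.1.2.1 p.2) ≠ 0 := fun p hp =>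
    (Real.sqrt_pos.2 (sub_cutPoint_pos hp.1.2.2.1 hp.1.2.2.2 _)).ne'
  refine ⟨?_, ?_, ?_, ?_⟩
  · exact ContinuousOn.div (by fun_prop) (by fun_prop) h2
  · exact ContinuousOn.div (by fun_prop) (by fun_prop)
      fun p hp => mul_ne_zero (h1 p hp) (pow_ne_zero _ (h2 p hp))
  · exact ContinuousOn.div (by fun_prop) (by fun_prop)
      fun p hp => mul_ne_zero (h1 p hp) (pow_ne_zero _ (h2 p hp))
  · exact ContinuousOn.div (by fun_prop) (by fun_prop) fun p hp => pow_ne_zero _ (h2 p hp)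

variable {a b c : ℝ}

theorem continuousAt_perInt {p : ℝ × ℝ × ℝ} (hp : p ∈ cutRegion) :
    ContinuousAt (fun p : ℝ × ℝ × ℝ => perInt p.1 p.2.1 p.2.2) p :=
  continuousAt_integral_of_continuousOn isOpen_cutRegion continuousOn_integrands.1 _ _ hp

theorem continuousAt_perA {p : ℝ × ℝ × ℝ} (hp : p ∈ cutRegion) :
    ContinuousAt (fun p : ℝ × ℝ × ℝ => perA p.1 p.2.1 p.2.2) p :=
  continuousAt_integral_of_continuousOn isOpen_cutRegion continuousOn_integrands.2.1 _ _ hp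

theorem continuousAt_perB {p : ℝ × ℝ × ℝ} (hp : p ∈ cutRegion) :
    ContinuousAt (fun p : ℝ × ℝ × ℝ => perB p.1 p.2.1 p.2.2) p :=
  continuousAt_integral_of_continuousOn isOpen_cutRegion continuousOn_integrands.2.2.1 _ _ hp

theorem continuousAt_perC {p : ℝ × ℝ × ℝ} (hp : p ∈ cutRegion) :
    ContinuousAt (fun p : ℝ × ℝ × ℝ => perC p.1 p.2.1 p.2.2) p :=
  continuousAt_integral_of_continuousOn isOpen_cutRegion continuousOn_integrands.2.2.2 _ _ hp

theorem continuous_integrands (ha : 0 < a) (hb : 0 < b) (hac : a < c) (hbc : b < c) :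
    Continuous (fun θ => √(cutPoint a b θ) / √(c - cutPoint a b θ)) ∧
    Continuous (fun θ => Real.cos θ ^ 2 / (√(cutPoint a b θ) * √(c - cutPoint a b θ) ^ 3)) ∧
    Continuous (fun θ => Real.sin θ ^ 2 / (√(cutPoint a b θ) * √(c - cutPoint a b θ) ^ 3)) ∧
    Continuous (fun θ => √(cutPoint a b θ) / √(c - cutPoint a b θ) ^ 3) := by
  have h1 : ∀ θ, √(cutPoint a b θ) ≠ 0 := fun θ => (Real.sqrt_pos.2 (cutPoint_pos ha hb θ)).ne'
  have h2 : ∀ θ, √(c - cutPoint a b θ) ≠ 0 := fun θ =>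
    (Real.sqrt_pos.2 (sub_cutPoint_pos hac hbc θ)).ne'
  refine ⟨?_, ?_, ?_, ?_⟩
  · exact Continuous.div (by fun_prop) (by fun_prop) h2
  · exact Continuous.div (by fun_prop) (by fun_prop)
      fun θ => mul_ne_zero (h1 θ) (pow_ne_zero _ (h2 θ))
  · exact Continuous.div (by fun_prop) (by fun_prop)
      fun θ => mul_ne_zero (h1 θ) (pow_ne_zero _ (h2 θ))
  · exact Continuous.div (by fun_prop) (by fun_prop) fun θ => pow_ne_zero _ (h2 θ)

theorem hasDerivAt_sqrt_div_sqrt {c x : ℝ} (hx : 0 < x) (hxc : x < c) :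
    HasDerivAt (fun x => √x / √(c - x)) (c / 2 / (√x * √(c - x) ^ 3)) x := by
  have h0 : 0 < c - x := sub_pos.2 hxc
  have h1 := Real.hasDerivAt_sqrt hx.ne'
  have h2 := ((hasDerivAt_id x).const_sub c).sqrt h0.ne'
  refine (h1.div h2 (Real.sqrt_pos.2 h0).ne').congr_deriv ?_
  have e1 := Real.sq_sqrt hx.le
  have e2 := Real.sq_sqrt h0.le
  have p1 := Real.sqrt_pos.2 hx
  have p2 := Real.sqrt_pos.2 h0
  simp only [id]
  field_simp
  linear_combination e1 + e2

theorem hasDerivAt_perInt_left (ha : 0 < a) (hb : 0 < b) (hac : a < c) (hbc : b < c) :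
    HasDerivAt (fun y => perInt y b c) (c / 2 * perA a b c) a := by
  unfold perInt perA
  rw [← intervalIntegral.integral_const_mul]
  refine hasDerivAt_integral_of_continuousOn (U := Set.Ioo 0 c)
    (f' := fun y θ => c / 2 * (Real.cos θ ^ 2 / (√(cutPoint y b θ) * √(c - cutPoint y b θ) ^ 3)))
    isOpen_Ioo (fun y hy => (continuous_integrands hy.1 hb hy.2 hbc).1) ?_ ?_ _ _ ⟨ha, hac⟩
  · refine continuousOn_const.mul (continuousOn_integrands.2.1.comp
      (f := fun p : ℝ × ℝ => ((p.1, b, c), p.2)) (by fun_prop) fun p hp => ?_)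
    exact ⟨⟨hp.1.1, hb, hp.1.2, hbc⟩, trivial⟩
  · intro y hy θ
    have h1 := hasDerivAt_sqrt_div_sqrt (cutPoint_pos hy.1 hb θ) (cutPoint_lt hy.2 hbc θ)
    have h2 : HasDerivAt (fun y => cutPoint y b θ) (Real.cos θ ^ 2) y := by
      unfold cutPoint
      simpa using ((hasDerivAt_id y).mul_const (Real.cos θ ^ 2)).add_const (b * Real.sin θ ^ 2)
    refine (HasDerivAt.comp y h1 h2).congr_deriv ?_
    ring

theorem hasDerivAt_perInt_middle (ha : 0 < a) (hb : 0 < b) (hac : a < c) (hbc : b < c) :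
    HasDerivAt (fun y => perInt a y c) (c / 2 * perB a b c) b := by
  unfold perInt perB
  rw [← intervalIntegral.integral_const_mul]
  refine hasDerivAt_integral_of_continuousOn (U := Set.Ioo 0 c)
    (f' := fun y θ => c / 2 * (Real.sin θ ^ 2 / (√(cutPoint a y θ) * √(c - cutPoint a y θ) ^ 3)))
    isOpen_Ioo (fun y hy => (continuous_integrands ha hy.1 hac hy.2).1) ?_ ?_ _ _ ⟨hb, hbc⟩
  · refine continuousOn_const.mul (continuousOn_integrands.2.2.1.comp
      (f := fun p : ℝ × ℝ => ((a, p.1, c), p.2)) (by fun_prop) fun p hp => ?_)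
    exact ⟨⟨ha, hp.1.1, hac, hp.1.2⟩, trivial⟩
  · intro y hy θ
    have h1 := hasDerivAt_sqrt_div_sqrt (cutPoint_pos ha hy.1 θ) (cutPoint_lt hac hy.2 θ)
    have h2 : HasDerivAt (fun y => cutPoint a y θ) (Real.sin θ ^ 2) y := by
      unfold cutPoint
      simpa using ((hasDerivAt_id y).mul_const (Real.sin θ ^ 2)).const_add (a * Real.cos θ ^ 2)
    refine (HasDerivAt.comp y h1 h2).congr_deriv ?_
    ring

theorem hasDerivAt_perInt_right (ha : 0 < a) (hb : 0 < b) (hac : a < c) (hbc : b < c) :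
    HasDerivAt (fun y => perInt a b y) (-(1 / 2) * perC a b c) c := by
  unfold perInt perC
  rw [← intervalIntegral.integral_const_mul]
  refine hasDerivAt_integral_of_continuousOn (U := Set.Ioi (max a b))
    (f' := fun y θ => -(1 / 2) * (√(cutPoint a b θ) / √(y - cutPoint a b θ) ^ 3))
    isOpen_Ioi (fun y hy => ?_) ?_ ?_ _ _ (max_lt hac hbc)
  · obtain ⟨h1, h2⟩ := max_lt_iff.1 (Set.mem_Ioi.1 hy)
    exact (continuous_integrands ha hb h1 h2).1
  · refine continuousOn_const.mul (continuousOn_integrands.2.2.2.comp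
      (f := fun p : ℝ × ℝ => ((a, b, p.1), p.2)) (by fun_prop) fun p hp => ?_)
    obtain ⟨h1, h2⟩ := max_lt_iff.1 (Set.mem_Ioi.1 hp.1)
    exact ⟨⟨ha, hb, h1, h2⟩, trivial⟩
  · intro y hy θ
    obtain ⟨h1, h2⟩ := max_lt_iff.1 (Set.mem_Ioi.1 hy)
    have h0 := sub_cutPoint_pos h1 h2 θ
    have h3 := ((hasDerivAt_id y).sub_const (cutPoint a b θ)).sqrt h0.ne'
    have p2 := Real.sqrt_pos.2 h0
    refine ((h3.inv p2.ne').const_mul (√(cutPoint a b θ))).congr_deriv ?_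
    simp only [id]
    field_simp

theorem perInt_pos (ha : 0 < a) (hb : 0 < b) (hac : a < c) (hbc : b < c) : 0 < perInt a b c :=
  intervalIntegral.intervalIntegral_pos_of_pos
    ((continuous_integrands ha hb hac hbc).1.intervalIntegrable _ _)
    (fun θ => div_pos (Real.sqrt_pos.2 (cutPoint_pos ha hb θ))
      (Real.sqrt_pos.2 (sub_cutPoint_pos hac hbc θ))) (by positivity)

theorem perC_pos (ha : 0 < a) (hb : 0 < b) (hac : a < c) (hbc : b < c) : 0 < perC a b c :=
  intervalIntegral.intervalIntegral_pos_of_pos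
    ((continuous_integrands ha hb hac hbc).2.2.2.intervalIntegrable _ _)
    (fun θ => div_pos (Real.sqrt_pos.2 (cutPoint_pos ha hb θ))
      (pow_pos (Real.sqrt_pos.2 (sub_cutPoint_pos hac hbc θ)) 3)) (by positivity)

theorem cos_pos_of_mem_Ioo {θ : ℝ} (hθ : θ ∈ Set.Ioo 0 (Real.pi / 2)) : 0 < Real.cos θ :=
  Real.cos_pos_of_mem_Ioo ⟨by linarith [hθ.1, Real.pi_pos], hθ.2⟩

theorem sin_pos_of_mem_Ioo {θ : ℝ} (hθ : θ ∈ Set.Ioo 0 (Real.pi / 2)) : 0 < Real.sin θ :=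
  Real.sin_pos_of_pos_of_lt_pi hθ.1 (by linarith [hθ.2, Real.pi_pos])

theorem perA_pos (ha : 0 < a) (hb : 0 < b) (hac : a < c) (hbc : b < c) : 0 < perA a b c := by
  refine intervalIntegral.intervalIntegral_pos_of_pos_on
    ((continuous_integrands ha hb hac hbc).2.1.intervalIntegrable _ _) (fun θ hθ => ?_)
    (by positivity)
  exact div_pos (pow_pos (cos_pos_of_mem_Ioo hθ) 2) (mul_pos (Real.sqrt_pos.2
    (cutPoint_pos ha hb θ)) (pow_pos (Real.sqrt_pos.2 (sub_cutPoint_pos hac hbc θ)) 3))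

theorem perB_pos (ha : 0 < a) (hb : 0 < b) (hac : a < c) (hbc : b < c) : 0 < perB a b c := by
  refine intervalIntegral.intervalIntegral_pos_of_pos_on
    ((continuous_integrands ha hb hac hbc).2.2.1.intervalIntegrable _ _) (fun θ hθ => ?_)
    (by positivity)
  exact div_pos (pow_pos (sin_pos_of_mem_Ioo hθ) 2) (mul_pos (Real.sqrt_pos.2
    (cutPoint_pos ha hb θ)) (pow_pos (Real.sqrt_pos.2 (sub_cutPoint_pos hac hbc θ)) 3))

end

noncomputable section

/-! ### The derivatives of the period and the speeds -/

theorem hasDerivAt_cutPoint (a b θ : ℝ) :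
    HasDerivAt (cutPoint a b) (2 * (b - a) * (Real.sin θ * Real.cos θ)) θ := by
  unfold cutPoint
  refine ((((Real.hasDerivAt_cos θ).pow 2).const_mul a).add
    (((Real.hasDerivAt_sin θ).pow 2).const_mul b)).congr_deriv ?_
  push_cast
  ring

variable {ν : ℝ} {u : Fin 3 → ℝ}

theorem shift_pos (hu : u ∈ domain ν) :
    0 < u 0 + ν ∧ 0 < u 1 + ν ∧ u 0 + ν < u 2 + ν ∧ u 1 + ν < u 2 + ν := by
  obtain ⟨h0, h1, h2⟩ := hu
  refine ⟨?_, ?_, ?_, ?_⟩ <;> linarith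

/-- Under `l = cutPoint (u 0) (u 1) θ` the factors `l - u 0` and `u 1 - l` of `R` become
`(u 1 - u 0) sin² θ` and `(u 1 - u 0) cos² θ`, which cancel against `dl`. -/
theorem substitution_cutPoint (hu : u ∈ domain ν) {θ : ℝ} (hθ : θ ∈ Set.Ioo 0 (Real.pi / 2)) :
    2 * (√(cutPoint (u 0 + ν) (u 1 + ν) θ) / √(u 2 + ν - cutPoint (u 0 + ν) (u 1 + ν) θ)) =
      ((fun l => (l + ν) / √(R ν u l)) ∘ cutPoint (u 0) (u 1)) θ *
        (2 * (u 1 - u 0) * (Real.sin θ * Real.cos θ)) := by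
  obtain ⟨h0, h1, h2⟩ := hu
  have ha : 0 < u 0 + ν := by linarith
  have hb : 0 < u 1 + ν := by linarith
  have hx := cutPoint_pos ha hb θ
  have hcx := sub_cutPoint_pos (show u 0 + ν < u 2 + ν by linarith)
    (show u 1 + ν < u 2 + ν by linarith) θ
  have hs := sin_pos_of_mem_Ioo hθ
  have hc := cos_pos_of_mem_Ioo hθ
  have hsc := Real.sin_sq_add_cos_sq θ
  have e : cutPoint (u 0) (u 1) θ + ν = cutPoint (u 0 + ν) (u 1 + ν) θ := by
    unfold cutPoint; linear_combination -ν * hsc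
  have hba : 0 < u 1 - u 0 := sub_pos.2 h1
  have hR : R ν u (cutPoint (u 0) (u 1) θ) = cutPoint (u 0 + ν) (u 1 + ν) θ *
      (u 2 + ν - cutPoint (u 0 + ν) (u 1 + ν) θ) *
      ((u 1 - u 0) * (Real.sin θ * Real.cos θ)) ^ 2 := by
    have e0 : cutPoint (u 0) (u 1) θ - u 0 = (u 1 - u 0) * Real.sin θ ^ 2 := by
      unfold cutPoint; linear_combination u 0 * hsc
    have e1 : cutPoint (u 0) (u 1) θ - u 1 = -((u 1 - u 0) * Real.cos θ ^ 2) := by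
      unfold cutPoint; linear_combination u 1 * hsc
    unfold R
    rw [e0, e1, ← e]
    ring
  simp only [Function.comp_apply]
  rw [e, hR, Real.sqrt_mul (by positivity), Real.sqrt_sq (by positivity), Real.sqrt_mul hx.le]
  have q1 := Real.sqrt_pos.2 hx
  have q2 := Real.sqrt_pos.2 hcx
  have q3 := Real.sq_sqrt hx.le
  generalize √(cutPoint (u 0 + ν) (u 1 + ν) θ) = X at *
  rw [← q3]
  field_simp

theorem intervalIntegrable_and_period_eq (hu : u ∈ domain ν) :
    IntervalIntegrable (fun l => (l + ν) / √(R ν u l)) volume (u 0) (u 1) ∧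
      period ν u = 4 * perInt (u 0 + ν) (u 1 + ν) (u 2 + ν) := by
  have h := hu
  obtain ⟨h0, h1, h2⟩ := h
  have hpi : (0 : ℝ) ≤ Real.pi / 2 := by positivity
  have hc : ContinuousOn (cutPoint (u 0) (u 1)) (Set.uIcc 0 (Real.pi / 2)) :=
    Continuous.continuousOn (by fun_prop)
  have hd : ∀ θ ∈ Set.Ioo (min 0 (Real.pi / 2)) (max 0 (Real.pi / 2)),
      HasDerivAt (cutPoint (u 0) (u 1)) (2 * (u 1 - u 0) * (Real.sin θ * Real.cos θ)) θ :=
    fun θ _ => hasDerivAt_cutPoint _ _ θ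
  have hn : ∀ θ ∈ Set.Ioo (min 0 (Real.pi / 2)) (max 0 (Real.pi / 2)),
      0 ≤ 2 * (u 1 - u 0) * (Real.sin θ * Real.cos θ) := by
    intro θ hθ
    rw [min_eq_left hpi, max_eq_right hpi] at hθ
    have := sin_pos_of_mem_Ioo hθ
    have := cos_pos_of_mem_Ioo hθ
    have := sub_pos.2 h1
    positivity
  have l0 : cutPoint (u 0) (u 1) 0 = u 0 := by simp [cutPoint]
  have l1 : cutPoint (u 0) (u 1) (Real.pi / 2) = u 1 := by simp [cutPoint]
  have hi := intervalIntegral.integrable_comp_mul_deriv_iff_of_deriv_nonneg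
    (g := fun l => (l + ν) / √(R ν u l)) hc hd hn
  have he := intervalIntegral.integral_comp_mul_deriv_of_deriv_nonneg
    (g := fun l => (l + ν) / √(R ν u l)) hc hd hn
  rw [l0, l1] at hi he
  refine ⟨hi.1 ?_, ?_⟩
  · obtain ⟨ha, hb, hac, hbc⟩ := shift_pos hu
    refine IntervalIntegrable.congr_uIoo
      (((continuous_integrands ha hb hac hbc).1.const_mul 2).intervalIntegrable _ _) fun θ hθ => ?_
    rw [Set.uIoo_of_le hpi] at hθ
    exact substitution_cutPoint hu hθ
  · unfold period perInt
    rw [← he, ← intervalIntegral.integral_congr_Ioo_of_le hpi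
      (fun θ hθ => substitution_cutPoint hu hθ), intervalIntegral.integral_const_mul]
    ring

theorem isOpen_domain : IsOpen (domain ν) := by
  unfold domain
  simp only [Set.ofPred_and]
  refine (isOpen_lt ?_ ?_).inter ((isOpen_lt ?_ ?_).inter (isOpen_lt ?_ ?_)) <;> fun_prop

/-- The partial derivatives of `4 * perInt`, hence of the period, in the variables
`a = u¹ + ν`, `b = u² + ν`, `c = u³ + ν`. -/
def perDeriv (i : Fin 3) (a b c : ℝ) : ℝ :=
  ![2 * c * perA a b c, 2 * c * perB a b c, -2 * perC a b c] i

theorem hasDerivAt_period (hu : u ∈ domain ν) (i : Fin 3) :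
    HasDerivAt (fun y => period ν (Function.update u i y))
      (perDeriv i (u 0 + ν) (u 1 + ν) (u 2 + ν)) (u i) := by
  have hev : (fun y => period ν (Function.update u i y)) =ᶠ[𝓝 (u i)] fun y =>
      4 * perInt (Function.update u i y 0 + ν) (Function.update u i y 1 + ν)
        (Function.update u i y 2 + ν) := by
    have hc : Continuous fun y => Function.update u i y := by fun_prop
    have hm : domain ν ∈ 𝓝 (Function.update u i (u i)) := by
      rw [Function.update_eq_self]; exact isOpen_domain.mem_nhds hu
    filter_upwards [hc.continuousAt.preimage_mem_nhds hm] with y hy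
    exact (intervalIntegrable_and_period_eq hy).2
  refine HasDerivAt.congr_of_eventuallyEq ?_ hev
  obtain ⟨h0, h1, h2⟩ := hu
  have ha : 0 < u 0 + ν := by linarith
  have hb : 0 < u 1 + ν := by linarith
  have hac : u 0 + ν < u 2 + ν := by linarith
  have hbc : u 1 + ν < u 2 + ν := by linarith
  fin_cases i
  · have := ((hasDerivAt_perInt_left ha hb hac hbc).comp_add_const (u 0) ν).const_mul 4
    simpa [perDeriv] using! this.congr_deriv (by ring)
  · have := ((hasDerivAt_perInt_middle ha hb hac hbc).comp_add_const (u 1) ν).const_mul 4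
    simpa [perDeriv] using! this.congr_deriv (by ring)
  · have := ((hasDerivAt_perInt_right ha hb hac hbc).comp_add_const (u 2) ν).const_mul 4
    simpa [perDeriv] using! this.congr_deriv (by ring)

theorem perDeriv_ne_zero {a b c : ℝ} (ha : 0 < a) (hb : 0 < b) (hac : a < c) (hbc : b < c)
    (i : Fin 3) : perDeriv i a b c ≠ 0 := by
  have hc : 0 < c := ha.trans hac
  have h1 := perA_pos ha hb hac hbc
  have h2 := perB_pos ha hb hac hbc
  have h3 := perC_pos ha hb hac hbc
  fin_cases i <;> simp [perDeriv, h1.ne', h2.ne', h3.ne', hc.ne']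

theorem period_pos (hu : u ∈ domain ν) : 0 < period ν u := by
  obtain ⟨ha, hb, hac, hbc⟩ := shift_pos hu
  rw [(intervalIntegrable_and_period_eq hu).2]
  exact mul_pos (by norm_num) (perInt_pos ha hb hac hbc)

theorem hasDerivAt_waveNumber (hu : u ∈ domain ν) (i : Fin 3) :
    HasDerivAt (fun y => waveNumber ν (Function.update u i y))
      (-(2 * Real.pi * perDeriv i (u 0 + ν) (u 1 + ν) (u 2 + ν) / period ν u ^ 2)) (u i) := by
  have hP := period_pos hu
  have h := hasDerivAt_period hu i
  have hne : period ν (Function.update u i (u i)) ≠ 0 := by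
    rw [Function.update_eq_self]; exact hP.ne'
  refine ((h.inv hne).const_mul (2 * Real.pi)).congr_deriv ?_
  rw [Function.update_eq_self]
  ring

theorem hasDerivAt_frequency (hu : u ∈ domain ν) (i : Fin 3) :
    HasDerivAt (fun y => frequency ν (Function.update u i y))
      (waveNumber ν u + (2 * ν + u 0 + u 1 + u 2) *
        -(2 * Real.pi * perDeriv i (u 0 + ν) (u 1 + ν) (u 2 + ν) / period ν u ^ 2)) (u i) := by
  have h1 : HasDerivAt (fun y => 2 * ν + Function.update u i y 0 + Function.update u i y 1 +
      Function.update u i y 2) 1 (u i) := by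
    fin_cases i
    · simpa using! (((hasDerivAt_id (u 0)).const_add (2 * ν)).add_const (u 1)).add_const (u 2)
    · simpa using! ((hasDerivAt_id (u 1)).const_add (2 * ν + u 0)).add_const (u 2)
    · simpa using! (hasDerivAt_id (u 2)).const_add (2 * ν + u 0 + u 1)
  refine (h1.mul (hasDerivAt_waveNumber hu i)).congr_deriv ?_
  simp only [Function.update_eq_self, one_mul]

theorem pderiv_waveNumber_ne_zero (hu : u ∈ domain ν) (i : Fin 3) :
    pderiv i (waveNumber ν) u ≠ 0 := by
  obtain ⟨ha, hb, hac, hbc⟩ := shift_pos hu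
  unfold pderiv
  rw [(hasDerivAt_waveNumber hu i).deriv]
  have h1 := (period_pos hu).ne'
  have h2 := perDeriv_ne_zero ha hb hac hbc i
  have h3 := Real.pi_ne_zero
  exact neg_ne_zero.2 (div_ne_zero (by positivity) (by positivity))

/-- Since `ω = (2ν + u¹ + u² + u³) k` and `k` is a multiple of the inverse period `P`, the speeds
are `2ν + u¹ + u² + u³ - P / ∂ᵢP`. -/
theorem speed_eq (hu : u ∈ domain ν) (i : Fin 3) :
    speed ν i u = u 0 + u 1 + u 2 + 2 * ν - 4 * perInt (u 0 + ν) (u 1 + ν) (u 2 + ν) /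
      perDeriv i (u 0 + ν) (u 1 + ν) (u 2 + ν) := by
  obtain ⟨ha, hb, hac, hbc⟩ := shift_pos hu
  have h1 := (period_pos hu).ne'
  have h2 := perDeriv_ne_zero ha hb hac hbc i
  have h3 := Real.pi_ne_zero
  unfold speed pderiv
  rw [(hasDerivAt_waveNumber hu i).deriv, (hasDerivAt_frequency hu i).deriv,
    ← (intervalIntegrable_and_period_eq hu).2]
  unfold waveNumber
  field_simp
  ring

/-- `P / ∂ᵢP` is positive for `i = 0, 1` and negative for `i = 2`. -/
theorem speed_lt_speed_two (hu : u ∈ domain ν) :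
    speed ν 0 u < speed ν 2 u ∧ speed ν 1 u < speed ν 2 u := by
  obtain ⟨ha, hb, hac, hbc⟩ := shift_pos hu
  have hc := ha.trans hac
  have h0 := perInt_pos ha hb hac hbc
  have h1 := perA_pos ha hb hac hbc
  have h2 := perB_pos ha hb hac hbc
  have h3 := perC_pos ha hb hac hbc
  have p0 := div_pos (mul_pos four_pos h0) (mul_pos (mul_pos two_pos hc) h1)
  have p1 := div_pos (mul_pos four_pos h0) (mul_pos (mul_pos two_pos hc) h2)
  have p2 := div_pos (mul_pos four_pos h0) (mul_pos two_pos h3)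
  rw [speed_eq hu, speed_eq hu, speed_eq hu]
  simp only [perDeriv, Matrix.cons_val, neg_mul, div_neg]
  constructor <;> linarith

end

noncomputable section

/-! ### Complete elliptic integrals -/

theorem one_sub_mul_sin_sq_pos {s : ℝ} (hs : s ^ 2 < 1) (ψ : ℝ) :
    0 < 1 - s ^ 2 * Real.sin ψ ^ 2 := by
  nlinarith [Real.sin_sq_le_one ψ, sq_nonneg s, sq_nonneg (Real.sin ψ)]

theorem continuous_inv_sqrt {s : ℝ} (hs : s ^ 2 < 1) :
    Continuous fun ψ => 1 / √(1 - s ^ 2 * Real.sin ψ ^ 2) :=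
  Continuous.div (by fun_prop) (by fun_prop)
    fun ψ => (Real.sqrt_pos.2 (one_sub_mul_sin_sq_pos hs ψ)).ne'

theorem continuous_inv_sqrt_cube {s : ℝ} (hs : s ^ 2 < 1) :
    Continuous fun ψ => 1 / √(1 - s ^ 2 * Real.sin ψ ^ 2) ^ 3 :=
  Continuous.div (by fun_prop) (by fun_prop)
    fun ψ => pow_ne_zero _ (Real.sqrt_pos.2 (one_sub_mul_sin_sq_pos hs ψ)).ne'

theorem hasDerivAt_ellF {s : ℝ} (hs : s ^ 2 < 1) (φ : ℝ) :
    HasDerivAt (fun φ => ellF φ s) (1 / √(1 - s ^ 2 * Real.sin φ ^ 2)) φ :=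
  (continuous_inv_sqrt hs).integral_hasStrictDerivAt 0 φ |>.hasDerivAt

/-- `ellF` is injective in the amplitude, so the inverse chosen in `jacobiAm` is a genuine one. -/
theorem jacobiAm_ellF {s : ℝ} (hs : s ^ 2 < 1) (φ : ℝ) : jacobiAm (ellF φ s) s = φ := by
  have h : StrictMono fun φ => ellF φ s := strictMono_of_deriv_pos fun φ => by
    rw [(hasDerivAt_ellF hs φ).deriv]
    exact one_div_pos.2 (Real.sqrt_pos.2 (one_sub_mul_sin_sq_pos hs φ))
  exact Function.leftInverse_invFun h.injective φ

/-- The complete integral of the third kind in trigonometric form. -/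
theorem ellLambda_ellK {s : ℝ} (hs : s ^ 2 < 1) (ρ : ℝ) :
    ellLambda (ellK s) ρ s = ∫ ψ in (0 : ℝ)..(Real.pi / 2),
      1 / ((1 - ρ ^ 2 * Real.sin ψ ^ 2) * √(1 - s ^ 2 * Real.sin ψ ^ 2)) := by
  have h := intervalIntegral.integral_comp_mul_deriv_of_deriv_nonneg
    (a := 0) (b := Real.pi / 2) (f := fun φ => ellF φ s)
    (f' := fun φ => 1 / √(1 - s ^ 2 * Real.sin φ ^ 2))
    (g := fun v => 1 / (1 - ρ ^ 2 * jacobiSn v s ^ 2))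
    (fun φ _ => (hasDerivAt_ellF hs φ).continuousAt.continuousWithinAt)
    (fun φ _ => hasDerivAt_ellF hs φ) (fun φ _ => by positivity)
  have h0 : ellF 0 s = 0 := by simp [ellF]
  have h1 : ellF (Real.pi / 2) s = ellK s := rfl
  simp only [h0, h1] at h
  unfold ellLambda
  rw [← h]
  refine intervalIntegral.integral_congr fun ψ _ => ?_
  simp only [Function.comp_apply, jacobiSn, jacobiAm_ellF hs]
  rw [one_div_mul_one_div]

/-- Integrate the derivative of `sin ψ cos ψ / √(1 - s² sin² ψ)`, which vanishes at both ends. -/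
theorem integral_inv_sqrt_cube {s : ℝ} (hs : s ^ 2 < 1) :
    (1 - s ^ 2) * ∫ ψ in (0 : ℝ)..(Real.pi / 2), 1 / √(1 - s ^ 2 * Real.sin ψ ^ 2) ^ 3 =
      ellE s := by
  have hd : ∀ ψ, HasDerivAt
      (fun ψ => s ^ 2 * (Real.sin ψ * Real.cos ψ / √(1 - s ^ 2 * Real.sin ψ ^ 2)))
      (√(1 - s ^ 2 * Real.sin ψ ^ 2) -
        (1 - s ^ 2) * (1 / √(1 - s ^ 2 * Real.sin ψ ^ 2) ^ 3)) ψ := by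
    intro ψ
    have hp := one_sub_mul_sin_sq_pos hs ψ
    have hD := Real.sqrt_pos.2 hp
    have hD2 := Real.sq_sqrt hp.le
    have h1 := ((((Real.hasDerivAt_sin ψ).pow 2).const_mul (s ^ 2)).const_sub 1).sqrt hp.ne'
    have h2 := ((((Real.hasDerivAt_sin ψ).mul (Real.hasDerivAt_cos ψ)).div h1 hD.ne').const_mul
      (s ^ 2))
    refine h2.congr_deriv ?_
    have hsc := Real.sin_sq_add_cos_sq ψ
    generalize √(1 - s ^ 2 * Real.sin ψ ^ 2) = D at *
    simp only [Pi.mul_apply]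
    field_simp
    have hc : Real.cos ψ ^ 2 = 1 - Real.sin ψ ^ 2 := by linarith
    have hD4 : D ^ 4 = (1 - s ^ 2 * Real.sin ψ ^ 2) ^ 2 := by rw [← hD2]; ring
    push_cast
    simp only [pow_one, hc, hD2, hD4]
    ring
  have hi1 : IntervalIntegrable (fun ψ => √(1 - s ^ 2 * Real.sin ψ ^ 2)) volume 0 (Real.pi / 2) :=
    Continuous.intervalIntegrable (by fun_prop) _ _
  have hi2 := ((continuous_inv_sqrt_cube hs).const_mul (1 - s ^ 2)).intervalIntegrable
    (μ := volume) 0 (Real.pi / 2)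
  have h := intervalIntegral.integral_eq_sub_of_hasDerivAt (fun ψ _ => hd ψ) (hi1.sub hi2)
  rw [intervalIntegral.integral_sub hi1 hi2, intervalIntegral.integral_const_mul] at h
  simp only [Real.sin_pi_div_two, Real.cos_pi_div_two, Real.sin_zero] at h
  unfold ellE
  simp at h
  simp
  linarith

/-- From `s² sin² = 1 - (1 - s² sin²)`. -/
theorem integral_sin_sq_div_cube {s : ℝ} (hs : s ^ 2 < 1) :
    s ^ 2 * ∫ ψ in (0 : ℝ)..(Real.pi / 2),
      Real.sin ψ ^ 2 * (1 / √(1 - s ^ 2 * Real.sin ψ ^ 2) ^ 3) = ellE s / (1 - s ^ 2) - ellK s := by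
  have hi1 := (continuous_inv_sqrt_cube hs).intervalIntegrable (μ := volume) 0 (Real.pi / 2)
  have hi2 := (continuous_inv_sqrt hs).intervalIntegrable (μ := volume) 0 (Real.pi / 2)
  rw [← integral_inv_sqrt_cube hs, mul_div_cancel_left₀ _ (by linarith : 1 - s ^ 2 ≠ 0)]
  unfold ellK
  rw [← intervalIntegral.integral_sub hi1 hi2, ← intervalIntegral.integral_const_mul]
  refine intervalIntegral.integral_congr fun ψ _ => ?_
  have hp := one_sub_mul_sin_sq_pos hs ψ
  have hD := Real.sqrt_pos.2 hp
  have hD2 := Real.sq_sqrt hp.le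
  generalize √(1 - s ^ 2 * Real.sin ψ ^ 2) = D at *
  field_simp
  linarith

theorem integral_cos_sq_div_cube {s : ℝ} (hs : s ^ 2 < 1) :
    s ^ 2 * ∫ ψ in (0 : ℝ)..(Real.pi / 2),
      Real.cos ψ ^ 2 * (1 / √(1 - s ^ 2 * Real.sin ψ ^ 2) ^ 3) = ellK s - ellE s := by
  have hi1 := (continuous_inv_sqrt_cube hs).intervalIntegrable (μ := volume) 0 (Real.pi / 2)
  have hi2 : IntervalIntegrable
      (fun ψ => Real.sin ψ ^ 2 * (1 / √(1 - s ^ 2 * Real.sin ψ ^ 2) ^ 3)) volume 0 (Real.pi / 2) :=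
    ((by fun_prop : Continuous fun ψ => Real.sin ψ ^ 2).mul
      (continuous_inv_sqrt_cube hs)).intervalIntegrable _ _
  have h1 := integral_inv_sqrt_cube hs
  have h2 := integral_sin_sq_div_cube hs
  have h3 : (∫ ψ in (0 : ℝ)..(Real.pi / 2),
      Real.cos ψ ^ 2 * (1 / √(1 - s ^ 2 * Real.sin ψ ^ 2) ^ 3)) =
      (∫ ψ in (0 : ℝ)..(Real.pi / 2), 1 / √(1 - s ^ 2 * Real.sin ψ ^ 2) ^ 3) -
      ∫ ψ in (0 : ℝ)..(Real.pi / 2), Real.sin ψ ^ 2 * (1 / √(1 - s ^ 2 * Real.sin ψ ^ 2) ^ 3) := by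
    rw [← intervalIntegral.integral_sub hi1 hi2]
    refine intervalIntegral.integral_congr fun ψ _ => ?_
    simp only [Real.cos_sq']
    ring
  have h4 : ellE s / (1 - s ^ 2) =
      ∫ ψ in (0 : ℝ)..(Real.pi / 2), 1 / √(1 - s ^ 2 * Real.sin ψ ^ 2) ^ 3 := by
    rw [← h1, mul_div_cancel_left₀ _ (by linarith : 1 - s ^ 2 ≠ 0)]
  rw [h3, mul_sub, h2, h4]
  linarith

/-! ### The period integrals in terms of elliptic integrals -/

/-- The substitution `tan θ = √(a / b) tan ψ` on `[0, π / 2]`. Under it, `sin² θ = a sin² ψ / y` and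
`cos² θ = b cos² ψ / y` with `y = a sin² ψ + b cos² ψ`, and `dθ = √(a b) dψ / y`. -/
theorem integral_comp_cutPoint {a b : ℝ} (ha : 0 < a) (hb : 0 < b) (G : ℝ → ℝ → ℝ) :
    ∫ θ in (0 : ℝ)..(Real.pi / 2), G (Real.cos θ ^ 2) (Real.sin θ ^ 2) =
    ∫ ψ in (0 : ℝ)..(Real.pi / 2), G (b * Real.cos ψ ^ 2 / cutPoint b a ψ)
      (a * Real.sin ψ ^ 2 / cutPoint b a ψ) * (√a * √b / cutPoint b a ψ) := by
  have hpi : (0 : ℝ) ≤ Real.pi / 2 := by positivity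
  have hy := cutPoint_pos hb ha
  have hry : ∀ ψ, √(cutPoint b a ψ) ≠ 0 := fun ψ => (Real.sqrt_pos.2 (hy ψ)).ne'
  have hq2 : ∀ ψ, (√a * Real.sin ψ / √(cutPoint b a ψ)) ^ 2 =
      a * Real.sin ψ ^ 2 / cutPoint b a ψ := fun ψ => by
    rw [div_pow, mul_pow, Real.sq_sqrt ha.le, Real.sq_sqrt (hy ψ).le]
  have hq2' : ∀ ψ, 1 - (√a * Real.sin ψ / √(cutPoint b a ψ)) ^ 2 =
      b * Real.cos ψ ^ 2 / cutPoint b a ψ := fun ψ => by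
    rw [hq2, eq_div_iff (hy ψ).ne', sub_mul, div_mul_cancel₀ _ (hy ψ).ne']
    unfold cutPoint; ring
  have hq1 : ∀ ψ, (√a * Real.sin ψ / √(cutPoint b a ψ)) ^ 2 ≤ 1 := fun ψ => by
    have : 0 ≤ b * Real.cos ψ ^ 2 / cutPoint b a ψ := by have := hy ψ; positivity
    linarith [hq2' ψ]
  have hc : Continuous fun ψ => Real.arcsin (√a * Real.sin ψ / √(cutPoint b a ψ)) :=
    Real.continuous_arcsin.comp (Continuous.div (by fun_prop) (by fun_prop) hry)
  -- `θ` is written as an arcsine, which is continuous up to `ψ = π / 2`, unlike `arctan ∘ tan`.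
  have h := intervalIntegral.integral_comp_mul_deriv_of_deriv_nonneg
    (a := 0) (b := Real.pi / 2) (f := fun ψ => Real.arcsin (√a * Real.sin ψ / √(cutPoint b a ψ)))
    (f' := fun ψ => √a * √b / cutPoint b a ψ)
    (g := fun θ => G (Real.cos θ ^ 2) (Real.sin θ ^ 2)) hc.continuousOn ?_ ?_
  · have e0 : Real.arcsin (√a * Real.sin 0 / √(cutPoint b a 0)) = 0 := by simp
    have e1 : Real.arcsin (√a * Real.sin (Real.pi / 2) / √(cutPoint b a (Real.pi / 2))) =
        Real.pi / 2 := by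
      simp [cutPoint, div_self (Real.sqrt_pos.2 ha).ne']
    simp only [e0, e1] at h
    rw [← h]
    refine intervalIntegral.integral_congr fun ψ _ => ?_
    simp only [Function.comp_apply]
    have habs := abs_le.1 ((sq_le_one_iff_abs_le_one _).1 (hq1 ψ))
    rw [Real.sin_arcsin habs.1 habs.2, Real.cos_sq', Real.sin_arcsin habs.1 habs.2, hq2', hq2]
  · intro ψ hψ
    rw [min_eq_left hpi, max_eq_right hpi] at hψ
    have hcos := cos_pos_of_mem_Ioo hψ
    have hsc := Real.sin_sq_add_cos_sq ψ
    have hlt : (√a * Real.sin ψ / √(cutPoint b a ψ)) ^ 2 < 1 := by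
      have : 0 < b * Real.cos ψ ^ 2 / cutPoint b a ψ := by have := hy ψ; positivity
      linarith [hq2' ψ]
    have habs := abs_lt.1 ((sq_lt_one_iff_abs_lt_one _).1 hlt)
    have d1 := Real.hasDerivAt_arcsin habs.1.ne' habs.2.ne
    have d2 := ((Real.hasDerivAt_sin ψ).const_mul (√a)).div
      ((hasDerivAt_cutPoint b a ψ).sqrt (hy ψ).ne') (hry ψ)
    refine (HasDerivAt.comp ψ d1 d2).congr_deriv ?_
    rw [hq2', Real.sqrt_div (by positivity), Real.sqrt_mul hb.le, Real.sqrt_sq hcos.le,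
      Real.sq_sqrt (hy ψ).le]
    have r1 := Real.sqrt_pos.2 (hy ψ)
    have r2 := Real.sq_sqrt (hy ψ).le
    have r3 := Real.sqrt_pos.2 hb
    have r4 := Real.sq_sqrt hb.le
    have hyψ := hy ψ
    have key : cutPoint b a ψ - (a - b) * Real.sin ψ ^ 2 = b := by
      unfold cutPoint; linear_combination b * hsc
    generalize √(cutPoint b a ψ) = Y at *
    generalize cutPoint b a ψ = y at *
    subst r2
    generalize √b = B at *
    field_simp
    linear_combination key - r4
  · intro ψ _
    have := hy ψ
    positivity

variable {a b c s : ℝ}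

theorem sq_modulus_lt_one (ha : 0 < a) (hab : a < b) (hbc : b < c)
    (hs : s ^ 2 * ((c - a) * b) = (b - a) * c) : s ^ 2 < 1 := by
  have h1 : 0 < (c - a) * b := mul_pos (by linarith) (by linarith)
  have h2 : 0 < a * (c - b) := mul_pos ha (by linarith)
  by_contra! h
  nlinarith

/-- The square roots of `x` and `c - x`, where `x = a b / y` with `y = cutPoint b a ψ` is the
point of the cut after the substitution of `integral_comp_cutPoint`, and `s` is the modulus. -/
theorem sqrt_cutPoint_factor (ha : 0 < a) (hab : a < b) (hbc : b < c)
    (hs : s ^ 2 * ((c - a) * b) = (b - a) * c) (ψ : ℝ) :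
    √(a * (b * Real.cos ψ ^ 2 / cutPoint b a ψ) + b * (a * Real.sin ψ ^ 2 / cutPoint b a ψ)) =
      √a * √b / √(cutPoint b a ψ) ∧
    √(c - (a * (b * Real.cos ψ ^ 2 / cutPoint b a ψ) +
        b * (a * Real.sin ψ ^ 2 / cutPoint b a ψ))) =
      √b * √(c - a) * √(1 - s ^ 2 * Real.sin ψ ^ 2) / √(cutPoint b a ψ) := by
  have hb := ha.trans hab
  have hy := cutPoint_pos hb ha ψ
  have hp := one_sub_mul_sin_sq_pos (sq_modulus_lt_one ha hab hbc hs) ψ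
  have hsc := Real.sin_sq_add_cos_sq ψ
  have hca : 0 < c - a := by linarith
  have e1 : a * (b * Real.cos ψ ^ 2 / cutPoint b a ψ) + b * (a * Real.sin ψ ^ 2 / cutPoint b a ψ)
      = a * b / cutPoint b a ψ := by
    field_simp; linear_combination hsc
  have e2 : c - a * b / cutPoint b a ψ =
      b * (c - a) * (1 - s ^ 2 * Real.sin ψ ^ 2) / cutPoint b a ψ := by
    field_simp
    unfold cutPoint
    linear_combination b * c * hsc + Real.sin ψ ^ 2 * hs
  refine ⟨?_, ?_⟩
  · rw [e1, Real.sqrt_div (by positivity), Real.sqrt_mul ha.le]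
  · rw [e1, e2, Real.sqrt_div (by positivity), Real.sqrt_mul (by positivity), Real.sqrt_mul hb.le]

theorem perInt_eq (ha : 0 < a) (hab : a < b) (hbc : b < c)
    (hs : s ^ 2 * ((c - a) * b) = (b - a) * c) {ρ : ℝ} (hρ : ρ ^ 2 * b = b - a) :
    perInt a b c = a / (√b * √(c - a)) * ellLambda (ellK s) ρ s := by
  have hb := ha.trans hab
  have hs1 := sq_modulus_lt_one ha hab hbc hs
  have h := integral_comp_cutPoint ha hb fun C S => √(a * C + b * S) / √(c - (a * C + b * S))
  unfold perInt
  rw [ellLambda_ellK hs1, ← intervalIntegral.integral_const_mul]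
  refine h.trans (intervalIntegral.integral_congr fun ψ _ => ?_)
  obtain ⟨e1, e2⟩ := sqrt_cutPoint_factor ha hab hbc hs ψ
  have hy := cutPoint_pos hb ha ψ
  have hyρ : cutPoint b a ψ = b * (1 - ρ ^ 2 * Real.sin ψ ^ 2) := by
    unfold cutPoint
    linear_combination b * Real.sin_sq_add_cos_sq ψ + Real.sin ψ ^ 2 * hρ
  rw [e1, e2]
  have r1 := Real.sqrt_pos.2 hy
  have r2 := Real.sqrt_pos.2 (one_sub_mul_sin_sq_pos hs1 ψ)
  have r3 := Real.sqrt_pos.2 ha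
  have r4 := Real.sqrt_pos.2 hb
  have r5 := Real.sqrt_pos.2 (show 0 < c - a by linarith)
  have q3 := Real.sq_sqrt ha.le
  have q4 := Real.sq_sqrt hb.le
  have hz : 0 < 1 - ρ ^ 2 * Real.sin ψ ^ 2 := by
    rw [hyρ] at hy; exact pos_of_mul_pos_right hy hb.le
  rw [hyρ] at r1 ⊢
  generalize 1 - ρ ^ 2 * Real.sin ψ ^ 2 = z at *
  generalize √(1 - s ^ 2 * Real.sin ψ ^ 2) = D at *
  generalize √(c - a) = F at *
  field_simp
  rw [q3, q4]
  ring

theorem perA_eq (ha : 0 < a) (hab : a < b) (hbc : b < c)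
    (hs : s ^ 2 * ((c - a) * b) = (b - a) * c) :
    s ^ 2 * perA a b c = 1 / (√b * √(c - a) ^ 3) * (ellK s - ellE s) := by
  have hb := ha.trans hab
  have hs1 := sq_modulus_lt_one ha hab hbc hs
  have h := integral_comp_cutPoint ha hb
    fun C S => C / (√(a * C + b * S) * √(c - (a * C + b * S)) ^ 3)
  unfold perA
  rw [← integral_cos_sq_div_cube hs1, mul_left_comm]
  congr 1
  rw [← intervalIntegral.integral_const_mul]
  refine h.trans (intervalIntegral.integral_congr fun ψ _ => ?_)
  obtain ⟨e1, e2⟩ := sqrt_cutPoint_factor ha hab hbc hs ψ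
  have hy := cutPoint_pos hb ha ψ
  rw [e1, e2]
  have r1 := Real.sqrt_pos.2 hy
  have r2 := Real.sqrt_pos.2 (one_sub_mul_sin_sq_pos hs1 ψ)
  have r3 := Real.sqrt_pos.2 ha
  have r4 := Real.sqrt_pos.2 hb
  have r5 := Real.sqrt_pos.2 (show 0 < c - a by linarith)
  have q1 := Real.sq_sqrt hy.le
  have q4 := Real.sq_sqrt hb.le
  generalize √(1 - s ^ 2 * Real.sin ψ ^ 2) = D at *
  generalize √(c - a) = F at *
  field_simp
  rw [show √(cutPoint b a ψ) ^ 4 = (√(cutPoint b a ψ) ^ 2) ^ 2 by ring, q1, q4]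
  ring

theorem perB_eq (ha : 0 < a) (hab : a < b) (hbc : b < c)
    (hs : s ^ 2 * ((c - a) * b) = (b - a) * c) :
    s ^ 2 * perB a b c =
      a / (b * √b * √(c - a) ^ 3) * (ellE s / (1 - s ^ 2) - ellK s) := by
  have hb := ha.trans hab
  have hs1 := sq_modulus_lt_one ha hab hbc hs
  have h := integral_comp_cutPoint ha hb
    fun C S => S / (√(a * C + b * S) * √(c - (a * C + b * S)) ^ 3)
  unfold perB
  rw [← integral_sin_sq_div_cube hs1, mul_left_comm]
  congr 1
  rw [← intervalIntegral.integral_const_mul]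
  refine h.trans (intervalIntegral.integral_congr fun ψ _ => ?_)
  obtain ⟨e1, e2⟩ := sqrt_cutPoint_factor ha hab hbc hs ψ
  have hy := cutPoint_pos hb ha ψ
  rw [e1, e2]
  have r1 := Real.sqrt_pos.2 hy
  have r2 := Real.sqrt_pos.2 (one_sub_mul_sin_sq_pos hs1 ψ)
  have r3 := Real.sqrt_pos.2 ha
  have r4 := Real.sqrt_pos.2 hb
  have r5 := Real.sqrt_pos.2 (show 0 < c - a by linarith)
  have q1 := Real.sq_sqrt hy.le
  have q4 := Real.sq_sqrt hb.le
  generalize √(1 - s ^ 2 * Real.sin ψ ^ 2) = D at *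
  generalize √(c - a) = F at *
  field_simp
  rw [show √(cutPoint b a ψ) ^ 4 = (√(cutPoint b a ψ) ^ 2) ^ 2 by ring, q1, q4]

theorem perC_eq (ha : 0 < a) (hab : a < b) (hbc : b < c)
    (hs : s ^ 2 * ((c - a) * b) = (b - a) * c) :
    (1 - s ^ 2) * perC a b c = a / (√b * √(c - a) ^ 3) * ellE s := by
  have hb := ha.trans hab
  have hs1 := sq_modulus_lt_one ha hab hbc hs
  have h := integral_comp_cutPoint ha hb
    fun C S => √(a * C + b * S) / √(c - (a * C + b * S)) ^ 3
  unfold perC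
  rw [← integral_inv_sqrt_cube hs1, mul_left_comm]
  congr 1
  rw [← intervalIntegral.integral_const_mul]
  refine h.trans (intervalIntegral.integral_congr fun ψ _ => ?_)
  obtain ⟨e1, e2⟩ := sqrt_cutPoint_factor ha hab hbc hs ψ
  have hy := cutPoint_pos hb ha ψ
  rw [e1, e2]
  have r1 := Real.sqrt_pos.2 hy
  have r2 := Real.sqrt_pos.2 (one_sub_mul_sin_sq_pos hs1 ψ)
  have r3 := Real.sqrt_pos.2 ha
  have r4 := Real.sqrt_pos.2 hb
  have r5 := Real.sqrt_pos.2 (show 0 < c - a by linarith)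
  have q1 := Real.sq_sqrt hy.le
  have q3 := Real.sq_sqrt ha.le
  generalize √(1 - s ^ 2 * Real.sin ψ ^ 2) = D at *
  generalize √(c - a) = F at *
  field_simp
  rw [q1, q3]
  ring

/-- The denominators do not vanish because they are nonzero multiples of the partial derivatives of
the period. -/
theorem speed_formulas {ν : ℝ} {u : Fin 3 → ℝ} (hu : u ∈ domain ν) :
    let s := modulus ν u
    let K := ellK s
    let E := ellE s
    let Λ := ellLambda K (rho ν u) s
    K - E ≠ 0 ∧
    K - (u 1 + ν) * (u 2 - u 0) / ((u 0 + ν) * (u 2 - u 1)) * E ≠ 0 ∧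
    E ≠ 0 ∧
    speed ν 0 u = u 0 + u 1 + u 2 + 2 * ν
      + 2 * ((u 0 + ν) * (u 0 - u 1) * Λ / ((u 1 + ν) * (K - E))) ∧
    speed ν 1 u = u 0 + u 1 + u 2 + 2 * ν
      + 2 * (u 1 - u 0) * Λ /
        (K - (u 1 + ν) * (u 2 - u 0) / ((u 0 + ν) * (u 2 - u 1)) * E) ∧
    speed ν 2 u = u 0 + u 1 + u 2 + 2 * ν
      + 2 * ((u 0 + ν) * (u 2 - u 1) * Λ / ((u 1 + ν) * E)) := by
  intro s K E Λ
  have hsp := speed_eq hu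
  obtain ⟨ha, hb, hac, hbc⟩ := shift_pos hu
  have hab : u 0 + ν < u 1 + ν := by linarith [hu.2.1]
  have eba : u 1 - u 0 = (u 1 + ν) - (u 0 + ν) := by ring
  have eca : u 2 - u 0 = (u 2 + ν) - (u 0 + ν) := by ring
  have ecb : u 2 - u 1 = (u 2 + ν) - (u 1 + ν) := by ring
  have hs : s ^ 2 * ((u 2 - u 0) * (u 1 + ν)) = (u 1 - u 0) * (u 2 + ν) := by
    have h1 : 0 < (u 2 - u 0) * (u 1 + ν) := mul_pos (by linarith) hb
    have h2 : 0 < (u 1 - u 0) * (u 2 + ν) := mul_pos (by linarith) (by linarith)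
    simp only [s, modulus]
    rw [Real.sq_sqrt (by positivity), div_mul_cancel₀ _ h1.ne']
  have hρ : rho ν u ^ 2 * (u 1 + ν) = u 1 - u 0 := by
    have h2 : 0 < u 1 - u 0 := by linarith
    simp only [rho]
    rw [Real.sq_sqrt (by positivity), div_mul_cancel₀ _ hb.ne']
  have ecd : u 0 - u 1 = -((u 1 + ν) - (u 0 + ν)) := by ring
  rw [ecd]
  rw [eba] at hρ hs ⊢
  rw [eca] at hs ⊢
  rw [ecb]
  have hI : perInt (u 0 + ν) (u 1 + ν) (u 2 + ν) =
      (u 0 + ν) / (√(u 1 + ν) * √((u 2 + ν) - (u 0 + ν))) * Λ := perInt_eq ha hab hbc hs hρ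
  have hA : s ^ 2 * perA (u 0 + ν) (u 1 + ν) (u 2 + ν) = _ * (K - E) := perA_eq ha hab hbc hs
  have hB : s ^ 2 * perB (u 0 + ν) (u 1 + ν) (u 2 + ν) = _ * (E / (1 - s ^ 2) - K) :=
    perB_eq ha hab hbc hs
  have hC : (1 - s ^ 2) * perC (u 0 + ν) (u 1 + ν) (u 2 + ν) = _ * E := perC_eq ha hab hbc hs
  have pA := perA_pos ha hb hac hbc
  have pB := perB_pos ha hb hac hbc
  have pC := perC_pos ha hb hac hbc
  have s0 := hsp 0
  have s1 := hsp 1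
  have s2 := hsp 2
  simp only [perDeriv, Matrix.cons_val] at s0 s1 s2
  rw [s0, s1, s2, hI]
  clear_value s K E Λ
  clear s0 s1 s2 hsp hI hρ
  generalize perA (u 0 + ν) (u 1 + ν) (u 2 + ν) = A at *
  generalize perB (u 0 + ν) (u 1 + ν) (u 2 + ν) = B at *
  generalize perC (u 0 + ν) (u 1 + ν) (u 2 + ν) = C at *
  generalize u 0 + u 1 + u 2 + 2 * ν = S at *
  clear eba eca ecb ecd hu
  generalize u 0 + ν = a at *
  generalize u 1 + ν = b at *
  generalize u 2 + ν = c at *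
  have hca : 0 < c - a := sub_pos.2 hac
  have hcb : 0 < c - b := sub_pos.2 hbc
  have hba : 0 < b - a := sub_pos.2 hab
  have hc : 0 < c := ha.trans hac
  have hs' : s ^ 2 = (b - a) * c / ((c - a) * b) := by
    rw [eq_div_iff (by positivity)]; exact hs
  -- The complementary modulus, which enters the formulas of `perB` and `perC`.
  have hs'' : 1 - s ^ 2 = a * (c - b) / ((c - a) * b) := by
    rw [hs']; field_simp; ring
  rw [hs''] at hB hC
  rw [hs'] at hA hB
  have hE' : E / (a * (c - b) / ((c - a) * b)) = b * (c - a) / (a * (c - b)) * E := by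
    field_simp
  rw [hE'] at hB
  have r4 := Real.sqrt_pos.2 hb
  have r5 := Real.sqrt_pos.2 hca
  have q4 := Real.sq_sqrt hb.le
  have q5 := Real.sq_sqrt hca.le
  generalize √b = X at *
  generalize √(c - a) = F at *
  have gA : A = (c - a) * b / ((b - a) * c) * (1 / (X * F ^ 3) * (K - E)) := by
    rw [← hA]; field_simp
  have gB : B = (c - a) * b / ((b - a) * c) *
      (a / (b * X * F ^ 3) * (b * (c - a) / (a * (c - b)) * E - K)) := by
    rw [← hB]; field_simp
  have gC : C = (c - a) * b / (a * (c - b)) * (a / (X * F ^ 3) * E) := by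
    rw [← hC]; field_simp
  have nA : K - E ≠ 0 := by rintro h; rw [h] at gA; simp at gA; exact pA.ne' gA
  have nB : b * (c - a) / (a * (c - b)) * E - K ≠ 0 := by
    rintro h; rw [h] at gB; simp at gB; exact pB.ne' gB
  have nC : E ≠ 0 := by rintro h; rw [h] at gC; simp at gC; exact pC.ne' gC
  refine ⟨nA, fun h => nB (by linarith), nC, ?_, ?_, ?_⟩
  · rw [gA]
    field_simp
    rw [q5]
    ring
  · rw [gB, ← neg_sub (b * (c - a) / (a * (c - b)) * E) K]
    generalize b * (c - a) / (a * (c - b)) * E - K = Z at *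
    field_simp
    rw [q5]
    ring
  · rw [gC]
    field_simp
    rw [q5]
    ring

end

noncomputable section

/-! ### Asymptotics of the period integrals as `b` and `c` coalesce -/

/-- The integral of `(c - x)^(-1/2)` over the cut; it diverges logarithmically as `c - b → 0`. -/
def logInt (a b c : ℝ) : ℝ := ∫ θ in (0 : ℝ)..(Real.pi / 2), 1 / √(c - cutPoint a b θ)

/-- The integral of `(c - x)^(-3/2)` over the cut; it diverges like `(c - b)⁻¹` as `c - b → 0`. -/
def cubeInt (a b c : ℝ) : ℝ := ∫ θ in (0 : ℝ)..(Real.pi / 2), 1 / √(c - cutPoint a b θ) ^ 3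

theorem ellE_le (s : ℝ) : ellE s ≤ Real.pi / 2 := by
  have h : ellE s ≤ ∫ _ in (0 : ℝ)..(Real.pi / 2), (1 : ℝ) := by
    refine intervalIntegral.integral_mono_on (by positivity)
      (Continuous.intervalIntegrable (by fun_prop) _ _) (by simp) fun ψ _ => ?_
    refine Real.sqrt_le_iff.2 ⟨zero_le_one, ?_⟩
    linarith [mul_nonneg (sq_nonneg s) (sq_nonneg (Real.sin ψ))]
  simpa using h

theorem one_le_ellE {s : ℝ} (hs : s ^ 2 < 1) : 1 ≤ ellE s := by
  have h : ∫ ψ in (0 : ℝ)..(Real.pi / 2), Real.cos ψ ≤ ellE s := by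
    refine intervalIntegral.integral_mono_on (by positivity)
      (Continuous.intervalIntegrable (by fun_prop) _ _)
      (Continuous.intervalIntegrable (by fun_prop) _ _) fun ψ _ => ?_
    refine Real.le_sqrt_of_sq_le ?_
    rw [Real.cos_sq']
    nlinarith [sq_nonneg (Real.sin ψ)]
  simpa using h

variable {a b c : ℝ}

theorem continuous_inv_sqrt_sub (hac : a < c) (hbc : b < c) (n : ℕ) :
    Continuous fun θ => 1 / √(c - cutPoint a b θ) ^ n :=
  Continuous.div (by fun_prop) (by fun_prop)
    fun θ => pow_ne_zero _ (Real.sqrt_pos.2 (sub_cutPoint_pos hac hbc θ)).ne'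

theorem continuous_inv_sqrt_sub' (hac : a < c) (hbc : b < c) :
    Continuous fun θ => 1 / √(c - cutPoint a b θ) := by
  simpa using continuous_inv_sqrt_sub hac hbc 1

/-- Exact value of `cubeInt`, up to a complete elliptic integral of the second kind. -/
theorem exists_cubeInt_eq (hab : a < b) (hbc : b < c) :
    ∃ s : ℝ, s ^ 2 < 1 ∧ (c - b) * cubeInt a b c = ellE s / √(c - a) := by
  have hca : 0 < c - a := by linarith
  have hs : √((b - a) / (c - a)) ^ 2 = (b - a) / (c - a) :=
    Real.sq_sqrt (div_nonneg (by linarith) hca.le)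
  have hs1 : √((b - a) / (c - a)) ^ 2 < 1 := by
    rw [hs, div_lt_one hca]; linarith
  refine ⟨_, hs1, ?_⟩
  rw [← integral_inv_sqrt_cube hs1]
  have h : cubeInt a b c = 1 / √(c - a) ^ 3 * ∫ ψ in (0 : ℝ)..(Real.pi / 2),
      1 / √(1 - √((b - a) / (c - a)) ^ 2 * Real.sin ψ ^ 2) ^ 3 := by
    unfold cubeInt
    rw [← intervalIntegral.integral_const_mul]
    refine intervalIntegral.integral_congr fun ψ _ => ?_
    have e : c - cutPoint a b ψ =
        (c - a) * (1 - √((b - a) / (c - a)) ^ 2 * Real.sin ψ ^ 2) := by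
      rw [hs]; unfold cutPoint; field_simp; linear_combination -a * Real.sin_sq_add_cos_sq ψ
    rw [e, Real.sqrt_mul hca.le]
    field_simp
  have r := Real.sqrt_pos.2 hca
  have q := Real.sq_sqrt hca.le
  rw [h, hs]
  generalize (∫ ψ in (0 : ℝ)..(Real.pi / 2),
      1 / √(1 - (b - a) / (c - a) * Real.sin ψ ^ 2) ^ 3) = J
  field_simp
  rw [q]
  field_simp
  ring

theorem cubeInt_le (hab : a < b) (hbc : b < c) :
    (c - b) * cubeInt a b c ≤ Real.pi / 2 / √(c - a) := by
  obtain ⟨s, _, h⟩ := exists_cubeInt_eq hab hbc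
  rw [h]
  gcongr
  exact ellE_le s

theorem le_cubeInt (hab : a < b) (hbc : b < c) :
    1 / √(c - a) ≤ (c - b) * cubeInt a b c := by
  obtain ⟨s, hs, h⟩ := exists_cubeInt_eq hab hbc
  rw [h]
  gcongr
  exact one_le_ellE hs

theorem logInt_pos (hac : a < c) (hbc : b < c) : 0 < logInt a b c :=
  intervalIntegral.intervalIntegral_pos_of_pos
    ((continuous_inv_sqrt_sub' hac hbc).intervalIntegrable _ _)
    (fun θ => one_div_pos.2 (Real.sqrt_pos.2 (sub_cutPoint_pos hac hbc θ))) (by positivity)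

theorem cubeInt_pos (hac : a < c) (hbc : b < c) : 0 < cubeInt a b c :=
  intervalIntegral.intervalIntegral_pos_of_pos
    ((continuous_inv_sqrt_sub hac hbc 3).intervalIntegrable _ _)
    (fun θ => one_div_pos.2 (pow_pos (Real.sqrt_pos.2 (sub_cutPoint_pos hac hbc θ)) 3))
    (by positivity)

theorem logInt_le (hab : a < b) (hbc : b < c) : logInt a b c ≤ Real.pi / 2 / √(c - b) := by
  have h : logInt a b c ≤ ∫ _ in (0 : ℝ)..(Real.pi / 2), 1 / √(c - b) := by
    refine intervalIntegral.integral_mono_on (by positivity)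
      ((continuous_inv_sqrt_sub' (hab.trans hbc) hbc).intervalIntegrable _ _) (by simp)
      fun θ _ => ?_
    have := Real.sqrt_pos.2 (sub_pos.2 hbc)
    have := cutPoint_le hab.le θ
    gcongr
  refine h.trans_eq ?_
  rw [intervalIntegral.integral_const, smul_eq_mul]
  ring

/-- The logarithmic divergence of `logInt`, from
`√(c - x) ≤ √(c - b) + √(b - a) cos θ ≤ √(c - b) + √(b - a) (π / 2 - θ)`. -/
theorem le_logInt (hab : a < b) (hbc : b < c) :
    (Real.log (√(c - b) + √(b - a) * (Real.pi / 2)) - Real.log √(c - b)) / √(b - a) ≤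
      logInt a b c := by
  have hM := Real.sqrt_pos.2 (sub_pos.2 hab)
  have hε := Real.sqrt_pos.2 (sub_pos.2 hbc)
  have hpi : (0 : ℝ) ≤ Real.pi / 2 := by positivity
  have hpos : ∀ θ ∈ Set.uIcc 0 (Real.pi / 2), 0 < √(c - b) + √(b - a) * (Real.pi / 2 - θ) := by
    intro θ hθ
    rw [Set.uIcc_of_le hpi] at hθ
    have := sub_nonneg.2 hθ.2
    positivity
  have hc : ContinuousOn (fun θ => 1 / (√(c - b) + √(b - a) * (Real.pi / 2 - θ)))
      (Set.uIcc 0 (Real.pi / 2)) :=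
    ContinuousOn.div (by fun_prop) (by fun_prop) fun θ hθ => (hpos θ hθ).ne'
  have hd : ∀ θ ∈ Set.uIcc 0 (Real.pi / 2),
      HasDerivAt (fun θ => -(Real.log (√(c - b) + √(b - a) * (Real.pi / 2 - θ)) / √(b - a)))
        (1 / (√(c - b) + √(b - a) * (Real.pi / 2 - θ))) θ := by
    intro θ hθ
    have h1 := (((hasDerivAt_id θ).const_sub (Real.pi / 2)).const_mul √(b - a)).const_add √(c - b)
    refine ((h1.log (hpos θ hθ).ne').div_const √(b - a)).neg.congr_deriv ?_
    simp only [id]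
    have := hpos θ hθ
    field_simp
  have hint := intervalIntegral.integral_eq_sub_of_hasDerivAt hd hc.intervalIntegrable
  have hle : ∫ θ in (0 : ℝ)..(Real.pi / 2), 1 / (√(c - b) + √(b - a) * (Real.pi / 2 - θ)) ≤
      logInt a b c := by
    refine intervalIntegral.integral_mono_on hpi hc.intervalIntegrable
      ((continuous_inv_sqrt_sub' (hab.trans hbc) hbc).intervalIntegrable _ _) fun θ hθ => ?_
    refine one_div_le_one_div_of_le
      (Real.sqrt_pos.2 (sub_cutPoint_pos (hab.trans hbc) hbc θ)) ?_
    have hθ' := sub_nonneg.2 hθ.2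
    have hcos : |Real.cos θ| ≤ Real.pi / 2 - θ := by
      rw [← Real.sin_pi_div_two_sub]
      exact Real.abs_sin_le_abs.trans_eq (abs_of_nonneg hθ')
    refine Real.sqrt_le_iff.2 ⟨by positivity, ?_⟩
    have e : c - cutPoint a b θ = (c - b) + (b - a) * Real.cos θ ^ 2 := by
      unfold cutPoint; linear_combination b * -Real.sin_sq_add_cos_sq θ
    have e2 : Real.cos θ ^ 2 ≤ (Real.pi / 2 - θ) ^ 2 := sq_le_sq' (by
      linarith [neg_abs_le (Real.cos θ)]) (by linarith [le_abs_self (Real.cos θ)])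
    rw [e, add_sq, mul_pow, Real.sq_sqrt (sub_nonneg.2 hbc.le), Real.sq_sqrt (sub_nonneg.2 hab.le)]
    have := mul_le_mul_of_nonneg_left e2 (sub_nonneg.2 hab.le)
    have : 0 ≤ 2 * √(c - b) * (√(b - a) * (Real.pi / 2 - θ)) := by positivity
    linarith
  rw [hint] at hle
  refine le_trans (le_of_eq ?_) hle
  simp only [sub_self, mul_zero, add_zero, sub_zero]
  ring

theorem sqrt_sub_sqrt_le {x c : ℝ} (hx : 0 ≤ x) (hxc : x ≤ c) : √c - √x ≤ √(c - x) := by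
  have hxc' := sub_nonneg.2 hxc
  rw [sub_le_iff_le_add]
  refine Real.sqrt_le_iff.2 ⟨by positivity, ?_⟩
  have h : 0 ≤ 2 * √(c - x) * √x := by positivity
  rw [add_sq, Real.sq_sqrt hx, Real.sq_sqrt hxc']
  linarith

theorem perInt_le (ha : 0 < a) (hab : a < b) (hbc : b < c) :
    perInt a b c ≤ √c * logInt a b c := by
  have hac := hab.trans hbc
  unfold perInt logInt
  rw [← intervalIntegral.integral_const_mul]
  refine intervalIntegral.integral_mono_on (by positivity)
    ((continuous_integrands ha (ha.trans hab) hac hbc).1.intervalIntegrable _ _)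
    (((continuous_inv_sqrt_sub' hac hbc).const_mul _).intervalIntegrable _ _) fun θ _ => ?_
  rw [mul_one_div]
  gcongr
  exact (cutPoint_lt hac hbc θ).le

/-- `perInt` is asymptotic to `√c * logInt`, since `√c - √x ≤ √(c - x)`. -/
theorem le_perInt (ha : 0 < a) (hab : a < b) (hbc : b < c) :
    √c * logInt a b c - Real.pi / 2 ≤ perInt a b c := by
  have hac := hab.trans hbc
  have hi1 := ((continuous_inv_sqrt_sub' hac hbc).const_mul √c).intervalIntegrable
    (μ := volume) 0 (Real.pi / 2)
  have hi2 := (continuous_integrands ha (ha.trans hab) hac hbc).1.intervalIntegrable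
    (μ := volume) 0 (Real.pi / 2)
  have h : √c * logInt a b c - perInt a b c ≤ ∫ _ in (0 : ℝ)..(Real.pi / 2), (1 : ℝ) := by
    unfold perInt logInt
    rw [← intervalIntegral.integral_const_mul, ← intervalIntegral.integral_sub hi1 hi2]
    refine intervalIntegral.integral_mono_on (by positivity) (hi1.sub hi2) (by simp) fun θ _ => ?_
    have hr := Real.sqrt_pos.2 (sub_cutPoint_pos hac hbc θ)
    rw [mul_one_div, ← sub_div, div_le_one hr]
    exact sqrt_sub_sqrt_le (cutPoint_pos ha (ha.trans hab) θ).le (cutPoint_lt hac hbc θ).le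
  simp at h
  linarith

/-- The bounds rest on `(b - a) cos² θ = (c - x) - (c - b)`. -/
theorem perA_bounds (ha : 0 < a) (hab : a < b) (hbc : b < c) :
    logInt a b c / √c - Real.pi / 2 / (√a * √(c - a)) ≤ (b - a) * perA a b c ∧
      (b - a) * perA a b c ≤ logInt a b c / √c + Real.pi / 2 / a := by
  have hac := hab.trans hbc
  have hb := ha.trans hab
  have hc := ha.trans hac
  have hi1 := ((continuous_inv_sqrt_sub' hac hbc).const_mul (1 / √c)).intervalIntegrable
    (μ := volume) 0 (Real.pi / 2)
  have hi2 := ((continuous_inv_sqrt_sub hac hbc 3).const_mul ((c - b) / √a)).intervalIntegrable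
    (μ := volume) 0 (Real.pi / 2)
  have hi3 := ((continuous_integrands ha hb hac hbc).2.1.const_mul (b - a)).intervalIntegrable
    (μ := volume) 0 (Real.pi / 2)
  have e : ∀ θ, (b - a) * Real.cos θ ^ 2 = (c - cutPoint a b θ) - (c - b) := fun θ => by
    unfold cutPoint; linear_combination b * Real.sin_sq_add_cos_sq θ
  have pa := Real.sqrt_pos.2 ha
  have pc := Real.sqrt_pos.2 hc
  have hcb := sub_pos.2 hbc
  have e' : ∀ θ, (b - a) * (Real.cos θ ^ 2 / (√(cutPoint a b θ) * √(c - cutPoint a b θ) ^ 3)) =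
      1 / √(cutPoint a b θ) * (1 / √(c - cutPoint a b θ)) -
        (c - b) / √(cutPoint a b θ) * (1 / √(c - cutPoint a b θ) ^ 3) := by
    intro θ
    have r1 := Real.sqrt_pos.2 (cutPoint_pos ha hb θ)
    have r2 := Real.sqrt_pos.2 (sub_cutPoint_pos hac hbc θ)
    have q2 := Real.sq_sqrt (sub_cutPoint_pos hac hbc θ).le
    rw [← mul_div_assoc, e]
    nth_rewrite 1 [← q2]
    field_simp
  constructor
  · have h : (∫ θ in (0 : ℝ)..(Real.pi / 2), (1 / √c * (1 / √(c - cutPoint a b θ)) -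
        (c - b) / √a * (1 / √(c - cutPoint a b θ) ^ 3))) ≤ (b - a) * perA a b c := by
      unfold perA
      rw [← intervalIntegral.integral_const_mul]
      refine intervalIntegral.integral_mono_on (by positivity) (hi1.sub hi2) hi3 fun θ _ => ?_
      rw [e']
      have r1 := Real.sqrt_pos.2 (cutPoint_pos ha hb θ)
      have := cutPoint_lt hac hbc θ
      have := le_cutPoint hab.le θ
      gcongr
    rw [intervalIntegral.integral_sub hi1 hi2, intervalIntegral.integral_const_mul,
      intervalIntegral.integral_const_mul] at h
    have h2 := div_le_div_of_nonneg_right (cubeInt_le hab hbc) pa.le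
    change 1 / √c * logInt a b c - (c - b) / √a * cubeInt a b c ≤ _ at h
    calc logInt a b c / √c - Real.pi / 2 / (√a * √(c - a))
        = 1 / √c * logInt a b c - Real.pi / 2 / √(c - a) / √a := by
          rw [div_div (Real.pi / 2), mul_comm √a]; ring
      _ ≤ 1 / √c * logInt a b c - (c - b) * cubeInt a b c / √a := sub_le_sub_left h2 _
      _ = 1 / √c * logInt a b c - (c - b) / √a * cubeInt a b c := by ring
      _ ≤ _ := h
  · have hi4 : IntervalIntegrable (fun _ : ℝ => 1 / a) volume 0 (Real.pi / 2) := by simp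
    have h : (b - a) * perA a b c ≤
        ∫ θ in (0 : ℝ)..(Real.pi / 2), (1 / √c * (1 / √(c - cutPoint a b θ)) + 1 / a) := by
      unfold perA
      rw [← intervalIntegral.integral_const_mul]
      refine intervalIntegral.integral_mono_on (by positivity) hi3 (hi1.add hi4) fun θ _ => ?_
      rw [e']
      have hx := cutPoint_pos ha hb θ
      have r1 := Real.sqrt_pos.2 hx
      have r2 := Real.sqrt_pos.2 (sub_cutPoint_pos hac hbc θ)
      have hd := sqrt_sub_sqrt_le hx.le (cutPoint_lt hac hbc θ).le
      have hax : a ≤ √(cutPoint a b θ) * √c := by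
        calc a = √a * √a := (Real.mul_self_sqrt ha.le).symm
          _ ≤ _ := by
            have := le_cutPoint hab.le θ
            gcongr
      have h1 : (1 / √(cutPoint a b θ) - 1 / √c) * (1 / √(c - cutPoint a b θ)) ≤ 1 / a := by
        calc (1 / √(cutPoint a b θ) - 1 / √c) * (1 / √(c - cutPoint a b θ))
            = (√c - √(cutPoint a b θ)) / √(c - cutPoint a b θ) *
              (1 / (√(cutPoint a b θ) * √c)) := by field_simp
          _ ≤ 1 * (1 / a) := by
            gcongr
            exact (div_le_one r2).2 hd
          _ = 1 / a := one_mul _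
      have h2 : 0 ≤ (c - b) / √(cutPoint a b θ) * (1 / √(c - cutPoint a b θ) ^ 3) := by
        positivity
      linarith
    rw [intervalIntegral.integral_add hi1 hi4, intervalIntegral.integral_const_mul,
      intervalIntegral.integral_const, smul_eq_mul] at h
    unfold logInt
    refine h.trans_eq ?_
    ring

theorem sqrt_mul_cubeInt_le_perC (ha : 0 < a) (hab : a < b) (hbc : b < c) :
    √a * cubeInt a b c ≤ perC a b c := by
  have hac := hab.trans hbc
  unfold perC cubeInt
  rw [← intervalIntegral.integral_const_mul]
  refine intervalIntegral.integral_mono_on (by positivity)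
    (((continuous_inv_sqrt_sub hac hbc 3).const_mul _).intervalIntegrable _ _)
    ((continuous_integrands ha (ha.trans hab) hac hbc).2.2.2.intervalIntegrable _ _) fun θ _ => ?_
  rw [mul_one_div]
  gcongr
  exact le_cutPoint hab.le θ

/-- In the sum the numerators add up to `cos² + sin² = 1`. -/
theorem cubeInt_div_sqrt_le (ha : 0 < a) (hab : a < b) (hbc : b < c) :
    cubeInt a b c / √c ≤ perA a b c + perB a b c := by
  have hac := hab.trans hbc
  have hb := ha.trans hab
  have hi1 := (continuous_integrands ha hb hac hbc).2.1.intervalIntegrable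
    (μ := volume) 0 (Real.pi / 2)
  have hi2 := (continuous_integrands ha hb hac hbc).2.2.1.intervalIntegrable
    (μ := volume) 0 (Real.pi / 2)
  unfold perA perB cubeInt
  rw [← intervalIntegral.integral_add hi1 hi2, ← intervalIntegral.integral_div]
  refine intervalIntegral.integral_mono_on (by positivity)
    (((continuous_inv_sqrt_sub hac hbc 3).div_const _).intervalIntegrable _ _)
    (hi1.add hi2) fun θ _ => ?_
  have r1 := Real.sqrt_pos.2 (cutPoint_pos ha hb θ)
  have r2 := Real.sqrt_pos.2 (sub_cutPoint_pos hac hbc θ)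
  rw [← add_div, Real.cos_sq_add_sin_sq, div_div, mul_comm]
  gcongr
  exact (cutPoint_lt hac hbc θ).le

end

noncomputable section

/-! ### Limits of the ratios -/

section Asymptotics

variable {ι : Type*} {l : Filter ι} {a b c : ι → ℝ} {a₀ c₀ : ℝ}

theorem tendsto_logInt (h1 : a₀ < c₀) (ha : Tendsto a l (𝓝 a₀))
    (hb : Tendsto b l (𝓝 c₀)) (hc : Tendsto c l (𝓝 c₀))
    (hev : ∀ᶠ i in l, 0 < a i ∧ a i < b i ∧ b i < c i) :
    Tendsto (fun i => logInt (a i) (b i) (c i)) l atTop := by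
  have hM : Tendsto (fun i => √(b i - a i)) l (𝓝 √(c₀ - a₀)) := (hb.sub ha).sqrt
  have hε : Tendsto (fun i => √(c i - b i)) l (𝓝[>] 0) := by
    refine tendsto_nhdsWithin_iff.2 ⟨by simpa using (hc.sub hb).sqrt, ?_⟩
    filter_upwards [hev] with i hi using Real.sqrt_pos.2 (sub_pos.2 hi.2.2)
  have hMpos : 0 < √(c₀ - a₀) := Real.sqrt_pos.2 (sub_pos.2 h1)
  have hlog : Tendsto (fun i => -Real.log √(c i - b i)) l atTop :=
    tendsto_neg_atBot_atTop.comp (Real.tendsto_log_nhdsGT_zero.comp hε)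
  have hlog' : Tendsto (fun i => Real.log (√(c i - b i) + √(b i - a i) * (Real.pi / 2))) l
      (𝓝 (Real.log (0 + √(c₀ - a₀) * (Real.pi / 2)))) :=
    ((tendsto_nhds_of_tendsto_nhdsWithin hε).add (hM.mul_const _)).log (by positivity)
  have hbig : Tendsto (fun i => (Real.log (√(c i - b i) + √(b i - a i) * (Real.pi / 2)) -
      Real.log √(c i - b i)) / √(b i - a i)) l atTop := by
    simp only [sub_eq_add_neg, div_eq_mul_inv]
    exact (hlog'.add_atTop hlog).atTop_mul_pos (inv_pos.2 hMpos) (hM.inv₀ hMpos.ne')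
  refine tendsto_atTop_mono' l ?_ hbig
  filter_upwards [hev] with i hi using le_logInt hi.2.1 hi.2.2

theorem tendsto_logInt_div_cubeInt (ha : Tendsto a l (𝓝 a₀))
    (hb : Tendsto b l (𝓝 c₀)) (hc : Tendsto c l (𝓝 c₀))
    (hev : ∀ᶠ i in l, 0 < a i ∧ a i < b i ∧ b i < c i) :
    Tendsto (fun i => logInt (a i) (b i) (c i) / cubeInt (a i) (b i) (c i)) l (𝓝 0) := by
  have hlim : Tendsto (fun i => Real.pi / 2 * √(c i - a i) * √(c i - b i)) l (𝓝 0) := by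
    simpa using ((hc.sub ha).sqrt.const_mul (Real.pi / 2)).mul (hc.sub hb).sqrt
  refine squeeze_zero' ?_ ?_ hlim
  · filter_upwards [hev] with i hi
    have hac := hi.2.1.trans hi.2.2
    exact (div_pos (logInt_pos hac hi.2.2) (cubeInt_pos hac hi.2.2)).le
  · filter_upwards [hev] with i hi
    obtain ⟨_, hab, hbc⟩ := hi
    have hac := hab.trans hbc
    have hT := le_cubeInt hab hbc
    have hL := logInt_le hab hbc
    have pT := cubeInt_pos hac hbc
    have r1 := Real.sqrt_pos.2 (sub_pos.2 hac)
    have r2 := Real.sqrt_pos.2 (sub_pos.2 hbc)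
    have q2 := Real.sq_sqrt (sub_pos.2 hbc).le
    rw [div_le_iff₀ pT]
    rw [div_le_iff₀ r1] at hT
    refine hL.trans ?_
    rw [div_le_iff₀ r2]
    calc Real.pi / 2 = Real.pi / 2 * 1 := (mul_one _).symm
      _ ≤ Real.pi / 2 * ((c i - b i) * cubeInt (a i) (b i) (c i) * √(c i - a i)) := by gcongr
      _ = _ := by
        nth_rewrite 1 [← q2]
        ring

theorem tendsto_perInt_div_logInt (h1 : a₀ < c₀) (ha : Tendsto a l (𝓝 a₀))
    (hb : Tendsto b l (𝓝 c₀)) (hc : Tendsto c l (𝓝 c₀))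
    (hev : ∀ᶠ i in l, 0 < a i ∧ a i < b i ∧ b i < c i) :
    Tendsto (fun i => perInt (a i) (b i) (c i) / logInt (a i) (b i) (c i)) l (𝓝 √c₀) := by
  have hL := tendsto_logInt h1 ha hb hc hev
  have hlow : Tendsto (fun i => √(c i) - Real.pi / 2 / logInt (a i) (b i) (c i)) l (𝓝 √c₀) := by
    simpa using hc.sqrt.sub (hL.const_div_atTop (Real.pi / 2))
  refine tendsto_of_tendsto_of_tendsto_of_le_of_le' hlow hc.sqrt ?_ ?_
  · filter_upwards [hev] with i hi
    have pL := logInt_pos (hi.2.1.trans hi.2.2) hi.2.2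
    rw [le_div_iff₀ pL, sub_mul, div_mul_cancel₀ _ pL.ne']
    exact le_perInt hi.1 hi.2.1 hi.2.2
  · filter_upwards [hev] with i hi
    rw [div_le_iff₀ (logInt_pos (hi.2.1.trans hi.2.2) hi.2.2)]
    exact perInt_le hi.1 hi.2.1 hi.2.2

theorem tendsto_perA_div_logInt (h0 : 0 < a₀) (h1 : a₀ < c₀) (ha : Tendsto a l (𝓝 a₀))
    (hb : Tendsto b l (𝓝 c₀)) (hc : Tendsto c l (𝓝 c₀))
    (hev : ∀ᶠ i in l, 0 < a i ∧ a i < b i ∧ b i < c i) :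
    Tendsto (fun i => perA (a i) (b i) (c i) / logInt (a i) (b i) (c i)) l
      (𝓝 (1 / √c₀ / (c₀ - a₀))) := by
  have hL := tendsto_logInt h1 ha hb hc hev
  have hca : c₀ - a₀ ≠ 0 := (sub_pos.2 h1).ne'
  have hrc : √c₀ ≠ 0 := (Real.sqrt_pos.2 (h0.trans h1)).ne'
  have hra : √a₀ * √(c₀ - a₀) ≠ 0 :=
    (mul_pos (Real.sqrt_pos.2 h0) (Real.sqrt_pos.2 (sub_pos.2 h1))).ne'
  have hi : Tendsto (fun i => 1 / √(c i)) l (𝓝 (1 / √c₀)) := tendsto_const_nhds.div hc.sqrt hrc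
  have hlow : Tendsto (fun i => (1 / √(c i) - Real.pi / 2 / (√(a i) * √(c i - a i)) /
      logInt (a i) (b i) (c i)) / (b i - a i)) l (𝓝 (1 / √c₀ / (c₀ - a₀))) := by
    have h := (tendsto_const_nhds (x := Real.pi / 2)).div (ha.sqrt.mul (hc.sub ha).sqrt) hra
    simpa using! (hi.sub (h.div_atTop hL)).div (hb.sub ha) hca
  have hup : Tendsto (fun i => (1 / √(c i) + Real.pi / 2 / a i /
      logInt (a i) (b i) (c i)) / (b i - a i)) l (𝓝 (1 / √c₀ / (c₀ - a₀))) := by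
    have h := (tendsto_const_nhds (x := Real.pi / 2)).div ha h0.ne'
    simpa using! (hi.add (h.div_atTop hL)).div (hb.sub ha) hca
  refine tendsto_of_tendsto_of_tendsto_of_le_of_le' hlow hup ?_ ?_
  · filter_upwards [hev] with i hi
    have pL := logInt_pos (hi.2.1.trans hi.2.2) hi.2.2
    have hba := sub_pos.2 hi.2.1
    rw [div_le_div_iff₀ hba pL, sub_mul, div_mul_cancel₀ _ pL.ne', mul_comm (perA _ _ _)]
    refine le_trans (le_of_eq ?_) (perA_bounds hi.1 hi.2.1 hi.2.2).1
    ring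
  · filter_upwards [hev] with i hi
    have pL := logInt_pos (hi.2.1.trans hi.2.2) hi.2.2
    have hba := sub_pos.2 hi.2.1
    rw [div_le_div_iff₀ pL hba, add_mul, div_mul_cancel₀ _ pL.ne', mul_comm (perA _ _ _)]
    refine (perA_bounds hi.1 hi.2.1 hi.2.2).2.trans (le_of_eq ?_)
    ring

theorem tendsto_perInt_div_perA (h0 : 0 < a₀) (h1 : a₀ < c₀) (ha : Tendsto a l (𝓝 a₀))
    (hb : Tendsto b l (𝓝 c₀)) (hc : Tendsto c l (𝓝 c₀))
    (hev : ∀ᶠ i in l, 0 < a i ∧ a i < b i ∧ b i < c i) :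
    Tendsto (fun i => perInt (a i) (b i) (c i) / perA (a i) (b i) (c i)) l
      (𝓝 (c₀ * (c₀ - a₀))) := by
  have hca := sub_pos.2 h1
  have hrc := Real.sqrt_pos.2 (h0.trans h1)
  have h := (tendsto_perInt_div_logInt h1 ha hb hc hev).div
    (tendsto_perA_div_logInt h0 h1 ha hb hc hev) (by positivity)
  have e : √c₀ / (1 / √c₀ / (c₀ - a₀)) = c₀ * (c₀ - a₀) := by
    rw [div_div, div_div_eq_mul_div, div_one, ← mul_assoc, Real.mul_self_sqrt (h0.trans h1).le]
  rw [e] at h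
  refine h.congr' ?_
  filter_upwards [hev] with i hi
  exact div_div_div_cancel_right₀ (logInt_pos (hi.2.1.trans hi.2.2) hi.2.2).ne' _ _

theorem tendsto_perInt_div_cubeInt (h1 : a₀ < c₀) (ha : Tendsto a l (𝓝 a₀))
    (hb : Tendsto b l (𝓝 c₀)) (hc : Tendsto c l (𝓝 c₀))
    (hev : ∀ᶠ i in l, 0 < a i ∧ a i < b i ∧ b i < c i) :
    Tendsto (fun i => perInt (a i) (b i) (c i) / cubeInt (a i) (b i) (c i)) l (𝓝 0) := by
  have h := (tendsto_perInt_div_logInt h1 ha hb hc hev).mul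
    (tendsto_logInt_div_cubeInt ha hb hc hev)
  rw [mul_zero] at h
  refine h.congr' ?_
  filter_upwards [hev] with i hi
  exact div_mul_div_cancel₀ (logInt_pos (hi.2.1.trans hi.2.2) hi.2.2).ne'

theorem tendsto_perInt_div_perC (h0 : 0 < a₀) (h1 : a₀ < c₀) (ha : Tendsto a l (𝓝 a₀))
    (hb : Tendsto b l (𝓝 c₀)) (hc : Tendsto c l (𝓝 c₀))
    (hev : ∀ᶠ i in l, 0 < a i ∧ a i < b i ∧ b i < c i) :
    Tendsto (fun i => perInt (a i) (b i) (c i) / perC (a i) (b i) (c i)) l (𝓝 0) := by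
  have h := (tendsto_perInt_div_cubeInt h1 ha hb hc hev).div ha.sqrt (Real.sqrt_pos.2 h0).ne'
  rw [zero_div] at h
  refine squeeze_zero' ?_ ?_ h
  · filter_upwards [hev] with i hi
    have hac := hi.2.1.trans hi.2.2
    have hb := hi.1.trans hi.2.1
    exact (div_pos (perInt_pos hi.1 hb hac hi.2.2) (perC_pos hi.1 hb hac hi.2.2)).le
  · filter_upwards [hev] with i hi
    have hac := hi.2.1.trans hi.2.2
    have hb := hi.1.trans hi.2.1
    have := (perInt_pos hi.1 hb hac hi.2.2).le
    have := cubeInt_pos hac hi.2.2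
    have := Real.sqrt_pos.2 hi.1
    rw [Pi.div_apply, div_div]
    refine div_le_div_of_nonneg_left (by assumption) (by positivity) ?_
    rw [mul_comm]
    exact sqrt_mul_cubeInt_le_perC hi.1 hi.2.1 hi.2.2

/-- `perB` is bounded below by `cubeInt / √c - perA`, where `perA` is only of the
order of `logInt`. -/
theorem tendsto_perInt_div_perB (h0 : 0 < a₀) (h1 : a₀ < c₀) (ha : Tendsto a l (𝓝 a₀))
    (hb : Tendsto b l (𝓝 c₀)) (hc : Tendsto c l (𝓝 c₀))
    (hev : ∀ᶠ i in l, 0 < a i ∧ a i < b i ∧ b i < c i) :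
    Tendsto (fun i => perInt (a i) (b i) (c i) / perB (a i) (b i) (c i)) l (𝓝 0) := by
  have hrc := Real.sqrt_pos.2 (h0.trans h1)
  have hA : Tendsto (fun i => perA (a i) (b i) (c i) / cubeInt (a i) (b i) (c i)) l (𝓝 0) := by
    have h := (tendsto_perA_div_logInt h0 h1 ha hb hc hev).mul
      (tendsto_logInt_div_cubeInt ha hb hc hev)
    rw [mul_zero] at h
    refine h.congr' ?_
    filter_upwards [hev] with i hi
    exact div_mul_div_cancel₀ (logInt_pos (hi.2.1.trans hi.2.2) hi.2.2).ne'
  have hg : Tendsto (fun i => 1 / √(c i) - perA (a i) (b i) (c i) / cubeInt (a i) (b i) (c i)) l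
      (𝓝 (1 / √c₀)) := by
    simpa using! ((tendsto_const_nhds (x := (1 : ℝ))).div hc.sqrt hrc.ne').sub hA
  have hpos : 0 < 1 / √c₀ := by positivity
  have h := (tendsto_perInt_div_cubeInt h1 ha hb hc hev).div hg hpos.ne'
  rw [zero_div] at h
  refine squeeze_zero' ?_ ?_ h
  · filter_upwards [hev] with i hi
    have hac := hi.2.1.trans hi.2.2
    have hb := hi.1.trans hi.2.1
    exact (div_pos (perInt_pos hi.1 hb hac hi.2.2) (perB_pos hi.1 hb hac hi.2.2)).le
  · filter_upwards [hev, hg.eventually (lt_mem_nhds hpos)] with i hi hgi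
    have hac := hi.2.1.trans hi.2.2
    have hb := hi.1.trans hi.2.1
    have pT := cubeInt_pos hac hi.2.2
    rw [Pi.div_apply, div_div]
    refine div_le_div_of_nonneg_left (perInt_pos hi.1 hb hac hi.2.2).le (mul_pos pT hgi) ?_
    have := cubeInt_div_sqrt_le hi.1 hi.2.1 hi.2.2
    rw [mul_sub, mul_div_cancel₀ _ pT.ne', mul_one_div]
    linarith

end Asymptotics

/-! ### Limits of the speeds -/

variable {ν v w : ℝ}

theorem tendsto_shift (u₀ : Fin 3 → ℝ) (i : Fin 3) :
    Tendsto (fun u : Fin 3 → ℝ => u i + ν) (𝓝[domain ν] u₀) (𝓝 (u₀ i + ν)) :=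
  ((continuous_apply i).add continuous_const).continuousWithinAt

theorem tendsto_speed_of_ratio {u₀ : Fin 3 → ℝ} {i : Fin 3} {r C : ℝ}
    (hC : u₀ 0 + u₀ 1 + u₀ 2 + 2 * ν - r = C)
    (h : Tendsto (fun u : Fin 3 → ℝ => 4 * perInt (u 0 + ν) (u 1 + ν) (u 2 + ν) /
      perDeriv i (u 0 + ν) (u 1 + ν) (u 2 + ν)) (𝓝[domain ν] u₀) (𝓝 r)) :
    Tendsto (speed ν i) (𝓝[domain ν] u₀) (𝓝 C) := by
  have hS : Tendsto (fun u : Fin 3 → ℝ => u 0 + u 1 + u 2 + 2 * ν) (𝓝[domain ν] u₀)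
      (𝓝 (u₀ 0 + u₀ 1 + u₀ 2 + 2 * ν)) :=
    (by fun_prop : Continuous fun u : Fin 3 → ℝ => u 0 + u 1 + u 2 + 2 * ν).continuousWithinAt
  rw [← hC]
  refine (hS.sub h).congr' ?_
  filter_upwards [self_mem_nhdsWithin] with u hu using (speed_eq hu i).symm

/-- The speeds as `u²` and `u³` coalesce (solitons on the background `w`). -/
theorem tendsto_speed_soliton (h0 : -ν < w) (h1 : w < v) (i : Fin 3) :
    Tendsto (speed ν i) (𝓝[domain ν] ![w, v, v])
      (𝓝 (![3 * w + 2 * ν, w + 2 * v + 2 * ν, w + 2 * v + 2 * ν] i)) := by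
  have ha := tendsto_shift (ν := ν) ![w, v, v] 0
  have hb := tendsto_shift (ν := ν) ![w, v, v] 1
  have hc := tendsto_shift (ν := ν) ![w, v, v] 2
  simp only [Matrix.cons_val] at ha hb hc
  have hev : ∀ᶠ u : Fin 3 → ℝ in 𝓝[domain ν] ![w, v, v],
      0 < u 0 + ν ∧ u 0 + ν < u 1 + ν ∧ u 1 + ν < u 2 + ν := by
    filter_upwards [self_mem_nhdsWithin] with u hu
    obtain ⟨h0, h1, h2⟩ := hu
    refine ⟨?_, ?_, ?_⟩ <;> linarith
  have hw : 0 < w + ν := by linarith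
  have hwv : w + ν < v + ν := by linarith
  have hv : v + ν ≠ 0 := by linarith
  have H0 : Tendsto (speed ν 0) (𝓝[domain ν] ![w, v, v]) (𝓝 (3 * w + 2 * ν)) := by
    have h := ((tendsto_perInt_div_perA hw hwv ha hb hc hev).mul
      ((tendsto_const_nhds (x := (2 : ℝ))).div hc hv))
    refine tendsto_speed_of_ratio ?_ (h.congr fun u => ?_)
    · simp only [Matrix.cons_val]
      field_simp
      ring
    · simp only [perDeriv, Matrix.cons_val, Pi.div_apply]
      rw [div_mul_div_comm, ← mul_div_mul_left _ _ (two_ne_zero (α := ℝ))]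
      congr 1 <;> ring
  have H1 : Tendsto (speed ν 1) (𝓝[domain ν] ![w, v, v]) (𝓝 (w + 2 * v + 2 * ν)) := by
    have h := ((tendsto_perInt_div_perB hw hwv ha hb hc hev).mul
      ((tendsto_const_nhds (x := (2 : ℝ))).div hc hv))
    refine tendsto_speed_of_ratio ?_ (h.congr fun u => ?_)
    · simp only [Matrix.cons_val]
      ring
    · simp only [perDeriv, Matrix.cons_val, Pi.div_apply]
      rw [div_mul_div_comm, ← mul_div_mul_left _ _ (two_ne_zero (α := ℝ))]
      congr 1 <;> ring
  have H2 : Tendsto (speed ν 2) (𝓝[domain ν] ![w, v, v]) (𝓝 (w + 2 * v + 2 * ν)) := by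
    have h := (tendsto_perInt_div_perC hw hwv ha hb hc hev).mul_const (-2)
    refine tendsto_speed_of_ratio ?_ (h.congr fun u => ?_)
    · simp only [Matrix.cons_val]
      ring
    · simp only [perDeriv, Matrix.cons_val]
      ring
  fin_cases i
  exacts [H0, H1, H2]

theorem integral_sin_sq_quarter : ∫ θ in (0 : ℝ)..(Real.pi / 2), Real.sin θ ^ 2 = Real.pi / 4 := by
  rw [integral_sin_sq]
  simp
  ring

theorem integral_cos_sq_quarter : ∫ θ in (0 : ℝ)..(Real.pi / 2), Real.cos θ ^ 2 = Real.pi / 4 := by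
  rw [integral_cos_sq]
  simp
  ring

theorem cutPoint_self (a θ : ℝ) : cutPoint a a θ = a := by
  unfold cutPoint; linear_combination a * Real.sin_sq_add_cos_sq θ

theorem perInt_self (a c : ℝ) : perInt a a c = Real.pi / 2 * (√a / √(c - a)) := by
  simp [perInt, cutPoint_self, mul_div_assoc]

theorem perA_self (a c : ℝ) : perA a a c = Real.pi / 4 / (√a * √(c - a) ^ 3) := by
  simp only [perA, cutPoint_self]
  rw [intervalIntegral.integral_div, integral_cos_sq_quarter]

theorem perB_self (a c : ℝ) : perB a a c = Real.pi / 4 / (√a * √(c - a) ^ 3) := by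
  simp only [perB, cutPoint_self]
  rw [intervalIntegral.integral_div, integral_sin_sq_quarter]

theorem perC_self (a c : ℝ) : perC a a c = Real.pi / 2 * (√a / √(c - a) ^ 3) := by
  simp [perC, cutPoint_self, mul_div_assoc]

/-- The speeds as `u¹` and `u²` coalesce (linear waves on the background `w`). -/
theorem tendsto_speed_linear (h0 : -ν < v) (h1 : v < w) (i : Fin 3) :
    Tendsto (speed ν i) (𝓝[domain ν] ![v, v, w])
      (𝓝 (![2 * v + w + 2 * ν - 4 * (v + ν) * (w - v) / (w + ν),
        2 * v + w + 2 * ν - 4 * (v + ν) * (w - v) / (w + ν), 3 * w + 2 * ν] i)) := by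
  have hv : 0 < v + ν := by linarith
  have hvw : v + ν < w + ν := by linarith
  have hw : 0 < w + ν := hv.trans hvw
  have hmem : ((v + ν, v + ν, w + ν) : ℝ × ℝ × ℝ) ∈ cutRegion := ⟨hv, hv, hvw, hvw⟩
  have hp : Tendsto (fun u : Fin 3 → ℝ => (u 0 + ν, u 1 + ν, u 2 + ν)) (𝓝[domain ν] ![v, v, w])
      (𝓝 (v + ν, v + ν, w + ν)) :=
    (tendsto_shift ![v, v, w] 0).prodMk_nhds ((tendsto_shift ![v, v, w] 1).prodMk_nhds
      (tendsto_shift ![v, v, w] 2))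
  have hc := tendsto_shift (ν := ν) ![v, v, w] 2
  simp only [Matrix.cons_val] at hc
  have hI := (continuousAt_perInt hmem).tendsto.comp hp
  have hA := (continuousAt_perA hmem).tendsto.comp hp
  have hB := (continuousAt_perB hmem).tendsto.comp hp
  have hC := (continuousAt_perC hmem).tendsto.comp hp
  have pA := perA_pos hv hv hvw hvw
  have pB := perB_pos hv hv hvw hvw
  have pC := perC_pos hv hv hvw hvw
  have r1 := Real.sqrt_pos.2 hv
  have r2 := Real.sqrt_pos.2 (sub_pos.2 hvw)
  have q1 := Real.sq_sqrt hv.le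
  have q2 := Real.sq_sqrt (sub_pos.2 hvw).le
  have e : w - v = √(w + ν - (v + ν)) ^ 2 := by rw [q2]; ring
  have H0 : Tendsto (speed ν 0) (𝓝[domain ν] ![v, v, w])
      (𝓝 (2 * v + w + 2 * ν - 4 * (v + ν) * (w - v) / (w + ν))) := by
    refine tendsto_speed_of_ratio ?_
      ((hI.const_mul 4).div ((hc.const_mul 2).mul hA) (by positivity))
    simp only [perInt_self, perA_self, Matrix.cons_val]
    rw [e]
    field_simp
    rw [q1]
    ring
  have H1 : Tendsto (speed ν 1) (𝓝[domain ν] ![v, v, w])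
      (𝓝 (2 * v + w + 2 * ν - 4 * (v + ν) * (w - v) / (w + ν))) := by
    refine tendsto_speed_of_ratio ?_
      ((hI.const_mul 4).div ((hc.const_mul 2).mul hB) (by positivity))
    simp only [perInt_self, perB_self, Matrix.cons_val]
    rw [e]
    field_simp
    rw [q1]
    ring
  have H2 : Tendsto (speed ν 2) (𝓝[domain ν] ![v, v, w]) (𝓝 (3 * w + 2 * ν)) := by
    refine tendsto_speed_of_ratio ?_
      ((hI.const_mul 4).div (hC.const_mul (-2)) (by simp [pC.ne']))
    simp only [perInt_self, perC_self, Matrix.cons_val]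
    field_simp
    rw [q2]
    ring
  fin_cases i
  exacts [H0, H1, H2]

theorem soliton_mem_closure (h0 : -ν < w) (h1 : w < v) : ![w, v, v] ∈ closure (domain ν) := by
  have hc : Continuous fun t : ℝ => (![w, v, v + t] : Fin 3 → ℝ) := by fun_prop
  have h : Tendsto (fun t : ℝ => (![w, v, v + t] : Fin 3 → ℝ)) (𝓝[>] 0) (𝓝 ![w, v, v]) := by
    simpa using (hc.tendsto 0).mono_left nhdsWithin_le_nhds
  refine mem_closure_of_tendsto h ?_
  filter_upwards [self_mem_nhdsWithin] with t ht
  have ht : 0 < t := ht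
  refine ⟨?_, ?_, ?_⟩ <;> simp <;> linarith

theorem linear_mem_closure (h0 : -ν < v) (h1 : v < w) : ![v, v, w] ∈ closure (domain ν) := by
  have hc : Continuous fun t : ℝ => (![v, v + t, w] : Fin 3 → ℝ) := by fun_prop
  have h : Tendsto (fun t : ℝ => (![v, v + t, w] : Fin 3 → ℝ)) (𝓝[>] 0) (𝓝 ![v, v, w]) := by
    simpa using (hc.tendsto 0).mono_left nhdsWithin_le_nhds
  refine mem_closure_of_tendsto h ?_
  filter_upwards [Ioo_mem_nhdsGT (sub_pos.2 h1)] with t ht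
  obtain ⟨ht0, ht1⟩ := ht
  refine ⟨?_, ?_, ?_⟩ <;> simp <;> linarith

theorem limitSpeed_soliton (h0 : -ν < w) (h1 : w < v) (i : Fin 3) :
    limitSpeed ν i ![w, v, v] =
      ![3 * w + 2 * ν, w + 2 * v + 2 * ν, w + 2 * v + 2 * ν] i :=
  extendFrom_eq (soliton_mem_closure h0 h1) (tendsto_speed_soliton h0 h1 i)

theorem limitSpeed_linear (h0 : -ν < v) (h1 : v < w) (i : Fin 3) :
    limitSpeed ν i ![v, v, w] =
      ![2 * v + w + 2 * ν - 4 * (v + ν) * (w - v) / (w + ν),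
        2 * v + w + 2 * ν - 4 * (v + ν) * (w - v) / (w + ν), 3 * w + 2 * ν] i :=
  extendFrom_eq (linear_mem_closure h0 h1) (tendsto_speed_linear h0 h1 i)

/-! ### Reduction of the limiting equations -/

/-- A diagonal system is a list of scalar transport equations. -/
theorem solvesSystem_diagonal_iff {n : ℕ} (d : Fin n → (Fin n → ℝ) → ℝ) (S : Set (ℝ × ℝ))
    (U : ℝ → ℝ → Fin n → ℝ) :
    SolvesSystem (fun u => Matrix.diagonal fun i => d i u) S U ↔
      ∀ i, SolvesTransport (fun x t => d i (U x t)) S fun x t => U x t i := by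
  have key : ∀ x t, (DifferentiableAt ℝ (fun p : ℝ × ℝ => U p.1 p.2) (x, t) ∧
      deriv (fun t' => U x t') t +
        (Matrix.diagonal fun i => d i (U x t)) *ᵥ deriv (fun x' => U x' t) x = 0) ↔
      ∀ i, DifferentiableAt ℝ (fun p : ℝ × ℝ => U p.1 p.2 i) (x, t) ∧
        deriv (fun t' => U x t' i) t + d i (U x t) * deriv (fun x' => U x' t i) x = 0 := by
    intro x t
    rw [forall_and, differentiableAt_pi]
    refine and_congr_right fun hd => ?_
    have ht : ∀ i, DifferentiableAt ℝ (fun t' => U x t' i) t := fun i =>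
      DifferentiableAt.comp (g := fun p : ℝ × ℝ => U p.1 p.2 i) (f := fun t' => (x, t')) t (hd i)
        (by fun_prop)
    have hx : ∀ i, DifferentiableAt ℝ (fun x' => U x' t i) x := fun i =>
      DifferentiableAt.comp (g := fun p : ℝ × ℝ => U p.1 p.2 i) (f := fun x' => (x', t)) x (hd i)
        (by fun_prop)
    rw [deriv_pi ht, deriv_pi hx, funext_iff]
    refine forall_congr' fun i => ?_
    simp [Matrix.mulVec_diagonal]
  unfold SolvesSystem SolvesTransport
  constructor
  · exact fun h i x t hxt => (key x t).1 (h x t hxt) i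
  · exact fun h x t hxt => (key x t).2 fun i => h i x t hxt

theorem solvesTransport_congr {c c' : ℝ → ℝ → ℝ} {S : Set (ℝ × ℝ)} (w : ℝ → ℝ → ℝ)
    (h : ∀ x t, (x, t) ∈ S → c x t = c' x t) : SolvesTransport c S w ↔ SolvesTransport c' S w := by
  unfold SolvesTransport
  refine forall_congr' fun x => forall_congr' fun t => forall_congr' fun hxt => ?_
  rw [h x t hxt]

end

end CHWhitham

open CHWhitham in
theorem theorem2 (ν : ℝ) :
    -- the speeds are well defined and given by the explicit formulas
    (∀ u ∈ domain ν,
      IntervalIntegrable (fun l => (l + ν) / Real.sqrt (R ν u l)) volume (u 0) (u 1) ∧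
      0 < waveNumber ν u ∧
      (∀ i : Fin 3,
        DifferentiableAt ℝ (fun y => waveNumber ν (Function.update u i y)) (u i) ∧
        DifferentiableAt ℝ (fun y => frequency ν (Function.update u i y)) (u i) ∧
        pderiv i (waveNumber ν) u ≠ 0) ∧
      (let s := modulus ν u
       let K := ellK s
       let E := ellE s
       let Λ := ellLambda K (rho ν u) s
       K - E ≠ 0 ∧
       K - (u 1 + ν) * (u 2 - u 0) / ((u 0 + ν) * (u 2 - u 1)) * E ≠ 0 ∧
       E ≠ 0 ∧
       speed ν 0 u = u 0 + u 1 + u 2 + 2 * ν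
          + 2 * ((u 0 + ν) * (u 0 - u 1) * Λ / ((u 1 + ν) * (K - E))) ∧
       speed ν 1 u = u 0 + u 1 + u 2 + 2 * ν
          + 2 * (u 1 - u 0) * Λ /
            (K - (u 1 + ν) * (u 2 - u 0) / ((u 0 + ν) * (u 2 - u 1)) * E) ∧
       speed ν 2 u = u 0 + u 1 + u 2 + 2 * ν
          + 2 * ((u 0 + ν) * (u 2 - u 1) * Λ / ((u 1 + ν) * E)))) ∧
    -- hyperbolicity and ordering of the speeds
    (∀ u ∈ domain ν,
      IsHyperbolicMatrix (whithamMatrix ν u) ∧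
      speed ν 0 u < speed ν 2 u ∧ speed ν 1 u < speed ν 2 u) ∧
    -- the limits of the speeds when `u²` and `u³` coalesce at `v`
    (∀ w v : ℝ, -ν < w → w < v →
      (∀ i : Fin 3,
        Tendsto (speed ν i) (𝓝[domain ν] ![w, v, v]) (𝓝 (limitSpeed ν i ![w, v, v]))) ∧
      limitSpeed ν 0 ![w, v, v] = 3 * w + 2 * ν ∧
      limitSpeed ν 1 ![w, v, v] = limitSpeed ν 2 ![w, v, v]) ∧
    -- the limits of the speeds when `u¹` and `u²` coalesce at `v`
    (∀ v w : ℝ, -ν < v → v < w →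
      (∀ i : Fin 3,
        Tendsto (speed ν i) (𝓝[domain ν] ![v, v, w]) (𝓝 (limitSpeed ν i ![v, v, w]))) ∧
      limitSpeed ν 2 ![v, v, w] = 3 * w + 2 * ν ∧
      limitSpeed ν 0 ![v, v, w] = limitSpeed ν 1 ![v, v, w]) ∧
    -- reduction of the limiting equations to the dispersionless CH equation, case `u² = u³`
    (∀ (S : Set (ℝ × ℝ)), IsOpen S → ∀ w v : ℝ → ℝ → ℝ,
      (∀ x t : ℝ, (x, t) ∈ S → -ν < w x t ∧ w x t < v x t) →
      (SolvesSystem (limitMatrix ν) S (fun x t => ![w x t, v x t, v x t]) ↔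
        SolvesDispersionlessCH ν S w ∧
        SolvesTransport (fun x t => limitSpeed ν 1 ![w x t, v x t, v x t]) S v)) ∧
    -- reduction of the limiting equations to the dispersionless CH equation, case `u¹ = u²`
    (∀ (S : Set (ℝ × ℝ)), IsOpen S → ∀ v w : ℝ → ℝ → ℝ,
      (∀ x t : ℝ, (x, t) ∈ S → -ν < v x t ∧ v x t < w x t) →
      (SolvesSystem (limitMatrix ν) S (fun x t => ![v x t, v x t, w x t]) ↔
        SolvesDispersionlessCH ν S w ∧
        SolvesTransport (fun x t => limitSpeed ν 0 ![v x t, v x t, w x t]) S v)) := by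
  refine ⟨fun u hu => ⟨(intervalIntegrable_and_period_eq hu).1, ?_, fun i =>
    ⟨(hasDerivAt_waveNumber hu i).differentiableAt, (hasDerivAt_frequency hu i).differentiableAt,
      pderiv_waveNumber_ne_zero hu i⟩, speed_formulas hu⟩, fun u hu => ⟨⟨1, fun i => speed ν i u,
      isUnit_one, by simp [whithamMatrix]⟩, speed_lt_speed_two hu⟩, ?_, ?_, ?_, ?_⟩
  · exact mul_pos (by positivity) (inv_pos.2 (period_pos hu))
  · intro w v h0 h1
    exact ⟨fun i => tendsto_extendFrom ⟨_, tendsto_speed_soliton h0 h1 i⟩,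
      limitSpeed_soliton h0 h1 0,
      (limitSpeed_soliton h0 h1 1).trans (limitSpeed_soliton h0 h1 2).symm⟩
  · intro v w h0 h1
    exact ⟨fun i => tendsto_extendFrom ⟨_, tendsto_speed_linear h0 h1 i⟩,
      limitSpeed_linear h0 h1 2,
      (limitSpeed_linear h0 h1 0).trans (limitSpeed_linear h0 h1 1).symm⟩
  · intro S _ w v h
    refine (solvesSystem_diagonal_iff (limitSpeed ν) S _).trans ?_
    have h0 := solvesTransport_congr (S := S) w
      (fun x t hxt => limitSpeed_soliton (h x t hxt).1 (h x t hxt).2 0)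
    have h2 := solvesTransport_congr (S := S) v
      (fun x t hxt => (limitSpeed_soliton (h x t hxt).1 (h x t hxt).2 2).trans
        (limitSpeed_soliton (h x t hxt).1 (h x t hxt).2 1).symm)
    exact ⟨fun H => ⟨h0.1 (H 0), H 1⟩,
      fun H => Fin.forall_fin_succ.2 ⟨h0.2 H.1, Fin.forall_fin_two.2 ⟨H.2, h2.2 H.2⟩⟩⟩
  · intro S _ v w h
    refine (solvesSystem_diagonal_iff (limitSpeed ν) S _).trans ?_
    have h2 := solvesTransport_congr (S := S) w
      (fun x t hxt => limitSpeed_linear (h x t hxt).1 (h x t hxt).2 2)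
    have h1 := solvesTransport_congr (S := S) v
      (fun x t hxt => (limitSpeed_linear (h x t hxt).1 (h x t hxt).2 1).trans
        (limitSpeed_linear (h x t hxt).1 (h x t hxt).2 0).symm)
    exact ⟨fun H => ⟨h2.1 (H 2), H 0⟩,
      fun H => Fin.forall_fin_succ.2 ⟨H.2, Fin.forall_fin_two.2 ⟨h1.2 H.2, h2.2 H.1⟩⟩⟩
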